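/- Let $(X,d)$ be a metric space with a Borel measure $\mu$ such that $0<\mu(B(x,r))<\infty$ for every open ball of radius $r\in(0,\infty)$. For a measurable $f:X\to(0,\infty)$ and measurable $E\subseteq X$ write $f_E^-=\operatorname{ess\,inf}_E f$, $f_E^+=\operatorname{ess\,sup}_E f$, $f^\pm=f_X^\pm$. Let $\mathcal P_b^{\log}(X)$ be the set of measurable $f:X\to(0,\infty)$ with $0<f^-\le f^+<\infty$ for which there is $C_{\log}(1/f)>0$ with $|1/f(x)-1/f(y)|\le C_{\log}(1/f)/\log(e+1/d(x,y))$ for all $x,y\in X$. For a measurable $E\subseteq X$ and a bounded exponent $p$, $L^{p(\cdot)}(E)$ is the set of measurable $f$ with $\int_E|f|^{p(x)}\,d\mu<\infty$, with the Luxemburg quasi-norm $\|f\|_{L^{p(\cdot)}(E)}=\inf\{\lambda>0:\int_E|f/\lambda|^{p(x)}\,d\mu\le1\}$ ($\inf\emptyset=\infty$). For a measurable a.e. finite $u$ on $E$, $\mathcal D^{s(\cdot)}(u)$ is the set of functions $g:E\to[0,\infty]$ for which there is a $\mu$-null set $N$ with $|u(x)-u(y)|\le d(x,y)^{s(x)}g(x)+d(x,y)^{s(y)}g(y)$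 for all $x,y\in E\setminus N$; and $u\in\dot M^{s(\cdot),p(\cdot)}(E)$ means that $\inf\|g\|_{L^{p(\cdot)}(E)}<\infty$, the infimum being over the measurable $g\in\mathcal D^{s(\cdot)}(u)$. Write $u_B=\frac1{\mu(B)}\int_B u\,d\mu$. Let $Q,p,s\in\mathcal P_b^{\log}(X)$, $\delta\in(0,\infty)$, $b\in(0,1]$, $\sigma\in(1,\infty)$, and assume that $\mu(B(x,r))\ge b\,r^{Q(x)}$ for all $x\in X$ and $r\in(0,\delta]$. Let $m,M,L\in(0,\infty)$ be such that for each $f\in\{Q,p,s\}$ one has $m\le f^-$, $f^+\le M$, and the log-Hölder condition for $1/f$ holds with constant $L$. Below, $B_0=B(x_0,r_0)$ is any ball with $0<r_0\le\delta/\sigma$, $\sigma B_0=B(x_0,\sigma r_0)$, and $(u,g)$ is any pair with $u\in\dot M^{s(\cdot),p(\cdot)}(\sigma B_0)$ and $g\in\mathcal D^{s(\cdot)}(u)\cap L^{p(\cdot)}(\sigma B_0)$. (i) If $(Q-sp)^-\ge\theta>0$, then, with $\gamma=\frac{Qp}{Q-sp}$, $$\inf_{c\in\mathbb R}\|u-c\|_{L^{\gamma(\cdot)}(B_0)}\le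 C_S\left(\frac{\mu(B_0)}{r_0^{Q(x_0)}}\right)^{1/\gamma^-_{B_0}}\|g\|_{L^{p(\cdot)}(\sigma B_0)},$$ where $C_S>0$ depends only on $b,\sigma,\delta,m,M,L,\theta$. (ii) If $sp=Q$ on $X$, then $u$ is integrable on $B_0$ and, if $\|g\|_{L^{p(\cdot)}(\sigma B_0)}>0$, $$\frac1{\mu(B_0)}\int_{B_0}\exp\left(C_{MT1}\frac{|u(x)-u_{B_0}|}{\|g\|_{L^{p(\cdot)}(\sigma B_0)}}\right)d\mu(x)\le C_{MT2},$$ where $C_{MT1},C_{MT2}>0$ depend only on $b,\sigma,\delta,m,M,L$. (iii) If $(sp-Q)^-\ge\theta>0$, then, with $\alpha=s-Q/p$, $u$ is integrable on $B_0$ and $$\|u-u_{B_0}\|_{L^\infty(B_0)}\le C_H\,r_0^{\alpha(x_0)}\|g\|_{L^{p(\cdot)}(\sigma B_0)};$$ moreover there is a continuous $\tilde u$ on $B_0$ with $u=\tilde u$ a.e. on $B_0$ and, for all $x,y\in B_0$, $$|\tilde u(x)-\tilde u(y)|\le 2^{\alpha^++1}C_H\left(\frac{\sigma\delta}{(\sigma-1)r_0}\right)^{\alpha^+}\|g\|_{L^{p(\cdot)}(\sigma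 B_0)}\,d(x,y)^{\alpha(x)},$$ where $C_H>0$ depends only on $b,\sigma,\delta,m,M,L,\theta$. -/

import Mathlib

open MeasureTheory Set
open scoped ENNReal

universe u

noncomputable section

namespace VarExp

variable {X : Type*}

/-- `p` is a bounded variable exponent with `m ≤ p⁻` and `p⁺ ≤ M` (essential bounds), and `1/p` is
log-Hölder continuous with constant `L`. With `0 < m`, the class of bounded log-Hölder exponents
consists of the `p` for which this holds for some `m`, `M`, `L`. -/
structure IsLogHolderExponent [MetricSpace X] [MeasurableSpace X]
    (μ : Measure X) (m M L : ℝ) (p : X → ℝ) : Prop where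
  measurable : Measurable p
  pos : ∀ x, 0 < p x
  lower : ∀ᵐ x ∂μ, m ≤ p x
  upper : ∀ᵐ x ∂μ, p x ≤ M
  logHolder : ∀ x y, |1 / p x - 1 / p y| ≤ L / Real.log (Real.exp 1 + 1 / dist x y)

/-- Every ball of positive radius has positive and finite measure. -/
def IsMetricMeasure [MetricSpace X] [MeasurableSpace X] (μ : Measure X) : Prop :=
  ∀ (x : X) (r : ℝ), 0 < r → 0 < μ (Metric.ball x r) ∧ μ (Metric.ball x r) < ∞

/-- `μ(B(x,r)) ≥ b r^{Q(x)}` for all `x` and all `0 < r ≤ δ`. -/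
def LowerAhlfors [MetricSpace X] [MeasurableSpace X]
    (μ : Measure X) (b δ : ℝ) (Q : X → ℝ) : Prop :=
  ∀ (x : X) (r : ℝ), 0 < r → r ≤ δ → ENNReal.ofReal (b * r ^ Q x) ≤ μ (Metric.ball x r)

/-- The standing assumptions on a metric measure space and the three exponents on it. -/
structure Admissible [MetricSpace X] [MeasurableSpace X]
    (b δ m M L : ℝ) (μ : Measure X) (Q p s : X → ℝ) : Prop where
  metricMeasure : IsMetricMeasure μ
  dimension : IsLogHolderExponent μ m M L Q
  integrability : IsLogHolderExponent μ m M L p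
  smoothness : IsLogHolderExponent μ m M L s
  lowerAhlfors : LowerAhlfors μ b δ Q

/-- The semi-modular `∫ f^{p(x)} dμ` of a nonnegative extended-valued function. -/
def modular [MeasurableSpace X] (μ : Measure X) (p : X → ℝ) (f : X → ℝ≥0∞) : ℝ≥0∞ :=
  ∫⁻ x, f x ^ p x ∂μ

/-- The Luxemburg quasi-norm of a nonnegative function (of `|v|`, for a real function `v`), with
`inf ∅ = ∞`. -/
def luxNorm [MeasurableSpace X] (μ : Measure X) (p : X → ℝ) (f : X → ℝ≥0∞) : ℝ≥0∞ :=
  sInf {l : ℝ≥0∞ | l ≠ 0 ∧ l ≠ ∞ ∧ modular μ p (fun x => f x / l) ≤ 1}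

/-- Membership of a nonnegative function in the variable exponent Lebesgue space. -/
def MemLpVar [MeasurableSpace X] (μ : Measure X) (p : X → ℝ) (f : X → ℝ≥0∞) : Prop :=
  AEMeasurable f μ ∧ modular μ p f < ∞

/-- `g` is a scalar (Hajłasz) `s(·)`-gradient of `u` on the set `E`. -/
def IsScalarGradient [MetricSpace X] [MeasurableSpace X]
    (μ : Measure X) (E : Set X) (s : X → ℝ) (u : X → ℝ) (g : X → ℝ≥0∞) : Prop :=
  ∃ N : Set X, μ N = 0 ∧ ∀ x ∈ E \ N, ∀ y ∈ E \ N,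
    ENNReal.ofReal |u x - u y| ≤
      ENNReal.ofReal (dist x y ^ s x) * g x + ENNReal.ofReal (dist x y ^ s y) * g y

/-- The homogeneous Hajłasz–Sobolev functional of `u` on `E`: the infimum of the Luxemburg norms
of the measurable scalar gradients of `u`. -/
def hajlaszSeminorm [MetricSpace X] [MeasurableSpace X]
    (μ : Measure X) (E : Set X) (s p : X → ℝ) (u : X → ℝ) : ℝ≥0∞ :=
  ⨅ (g : X → ℝ≥0∞) (_ : AEMeasurable g (μ.restrict E)) (_ : IsScalarGradient μ E s u g),
    luxNorm (μ.restrict E) p g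

/-- Membership in the homogeneous Hajłasz–Sobolev space on `E`; only the values of `u` on `E`
matter. -/
def MemHajlaszSobolev [MetricSpace X] [MeasurableSpace X]
    (μ : Measure X) (E : Set X) (s p : X → ℝ) (u : X → ℝ) : Prop :=
  AEMeasurable u (μ.restrict E) ∧ hajlaszSeminorm μ E s p u < ∞

/-- The admissible pairs: `u` is in the homogeneous Hajłasz–Sobolev space on `E`, and `g` is a
scalar `s(·)`-gradient of `u` on `E` that lies in the variable exponent Lebesgue space on `E`. -/
def IsHajlaszPair [MetricSpace X] [MeasurableSpace X]
    (μ : Measure X) (E : Set X) (s p : X → ℝ) (u : X → ℝ) (g : X → ℝ≥0∞) : Prop :=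
  MemHajlaszSobolev μ E s p u ∧ IsScalarGradient μ E s u g ∧ MemLpVar (μ.restrict E) p g

/-- The Sobolev conjugate exponent `γ = Qp / (Q - sp)`. -/
def sobolevConj (Q p s : X → ℝ) : X → ℝ :=
  fun x => Q x * p x / (Q x - s x * p x)

/-- The Hölder exponent `α = s - Q/p`. -/
def holderExp (Q p s : X → ℝ) : X → ℝ :=
  fun x => s x - Q x / p x

/-- `D_H(r) = 2^{a+1} C (σδ / ((σ-1) r))^a`, to be used with `a = α⁺`. -/
def holderConst (σ δ C a r : ℝ) : ℝ :=
  2 ^ (a + 1) * C * (σ * δ / ((σ - 1) * r)) ^ a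

end VarExp

end

/-!
By homogeneity the gradient `g` may be taken to have modular at most one. Since
`μ (B(x,r)) ≥ b r ^ Q(x)`, every ball of radius `r ≤ δ` then contains a good point, at which
`g ≤ A r ^ (-Q(x) / p(x))`; log-Hölder continuity makes it harmless to evaluate the exponents at the
centre instead. Values of `u` at good points of comparable balls thus differ by at most a multiple
of `r ^ (s(x) - Q(x) / p(x))`. Following Hedberg, telescope these differences over dyadic radii from
`ρ` down to the scale `t` with `t ^ (-Q(x) / p(x)) = max (g x) (ρ ^ (-Q(x) / p(x)))`, at which `x`
is itself a good point. With all exponents taken at `x`, the sum is governed by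

* its last term `t ^ (s - Q / p)` if `s p < Q`; its power with exponent `γ = Q p / (Q - s p)` is
  `t ^ (-Q) ≤ g ^ p + ρ ^ (-Q)`, which is integrable;
* the number of its terms, about `log (ρ / t)`, if `s p = Q`; its exponential is then a power of
  `ρ / t`, again controlled by `g ^ p`;
* its first term `ρ ^ (s - Q / p)` if `s p > Q`; taking `ρ` comparable to `d(x, y)` gives Hölder
  continuity.
-/

noncomputable section

namespace VarExp

open Filter Topology

variable {X : Type*}

section LogModulus

/-- `f` has modulus of continuity `Λ / log (e + 1 / d)`. -/
def HasLogModulus [MetricSpace X] (Λ : ℝ) (f : X → ℝ) : Prop :=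
  ∀ x y, |f x - f y| ≤ Λ / Real.log (Real.exp 1 + 1 / dist x y)

/-- The factor by which `r ^ f` may vary between points at distance at most `K r`, where `r ≤ δ`,
if `f` has logarithmic modulus of continuity with constant `Λ`. -/
def oscFactor (δ Λ K : ℝ) : ℝ := Real.exp (Λ * (K + 1 + δ))

lemma oscFactor_pos (δ Λ K : ℝ) : 0 < oscFactor δ Λ K := Real.exp_pos _

lemma one_le_oscFactor {δ Λ K : ℝ} (hδ : 0 ≤ δ) (hΛ : 0 ≤ Λ) (hK : 0 ≤ K) :
    1 ≤ oscFactor δ Λ K :=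
  Real.one_le_exp (by positivity)

/-- The factor relating `(τ r) ^ f` on a ball of radius `r`, where `τ r ≤ δ`, to the value of
`r ^ f` at the centre, if moreover `|f| ≤ M`. -/
def scaleFactor (δ Λ M τ : ℝ) : ℝ := oscFactor δ Λ τ⁻¹ * Real.exp (M * |Real.log τ|)

lemma scaleFactor_pos (δ Λ M τ : ℝ) : 0 < scaleFactor δ Λ M τ :=
  mul_pos (oscFactor_pos _ _ _) (Real.exp_pos _)

lemma one_le_log_exp_one_add {t : ℝ} (ht : 0 ≤ t) : 1 ≤ Real.log (Real.exp 1 + t) := by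
  rw [Real.le_log_iff_exp_le (by positivity)]
  linarith

/-- This is where the logarithm in the modulus of continuity is used: up to a factor `K + 1 + δ`
it dominates `|log r|` at all distances at most `K r`. -/
lemma abs_log_le_mul_log {δ K d r : ℝ} (hd : 0 < d) (hr : 0 < r) (hrδ : r ≤ δ) (hdr : d ≤ K * r) :
    |Real.log r| ≤ (K + 1 + δ) * Real.log (Real.exp 1 + 1 / d) := by
  have hK : 0 < K := pos_of_mul_pos_left (hd.trans_le hdr) hr.le
  have hl : 1 ≤ Real.log (Real.exp 1 + 1 / d) := one_le_log_exp_one_add (by positivity)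
  rcases le_total 1 r with h1 | h1
  · rw [abs_of_nonneg (Real.log_nonneg h1)]
    nlinarith [Real.log_le_self hr.le]
  · rw [abs_of_nonpos (Real.log_nonpos hr.le h1)]
    have hlog_d : Real.log d ≤ Real.log K + Real.log r := by
      rw [← Real.log_mul hK.ne' hr.ne']
      exact Real.log_le_log hd hdr
    have hlog_inv : -Real.log d ≤ Real.log (Real.exp 1 + 1 / d) := by
      rw [← Real.log_inv, ← one_div]
      exact Real.log_le_log (by positivity) (by linarith [Real.exp_pos 1])
    nlinarith [Real.log_le_self hK.le]

variable [MetricSpace X] {Λ Λ' : ℝ} {f g : X → ℝ}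

namespace HasLogModulus

lemma nonneg (hf : HasLogModulus Λ f) (x : X) : 0 ≤ Λ := by
  simpa using hf x x

lemma continuous (hf : HasLogModulus Λ f) : Continuous f := by
  refine continuous_iff_continuousAt.2 fun x => continuousAt_iff_punctured_nhds.2 ?_
  rw [tendsto_iff_dist_tendsto_zero]
  have hdist : Tendsto (fun y => dist y x) (𝓝[≠] x) (𝓝[>] 0) := by
    refine tendsto_nhdsWithin_iff.2 ⟨?_, ?_⟩
    · exact (tendsto_iff_dist_tendsto_zero.1 tendsto_id).mono_left nhdsWithin_le_nhds
    · filter_upwards [self_mem_nhdsWithin] with y hy using dist_pos.2 hy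
  refine squeeze_zero (fun _ => dist_nonneg) (fun y => hf y x) ?_
  refine Tendsto.const_div_atTop (Real.tendsto_log_atTop.comp
    (tendsto_atTop_add_const_left _ _ ?_)) _
  simpa only [one_div, Function.comp_def] using tendsto_inv_nhdsGT_zero.comp hdist

lemma abs_mul_log_le {δ K r : ℝ} (hf : HasLogModulus Λ f) (hr : 0 < r) (hrδ : r ≤ δ) {x y : X}
    (hxy : dist x y ≤ K * r) : |f x - f y| * |Real.log r| ≤ Λ * (K + 1 + δ) := by
  have hΛ := hf.nonneg x
  rcases eq_or_ne x y with rfl | hne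
  · have hK : 0 ≤ K := nonneg_of_mul_nonneg_left (dist_nonneg.trans hxy) hr
    have hδ : 0 ≤ δ := hr.le.trans hrδ
    rw [sub_self, abs_zero, zero_mul]
    positivity
  · have hl := one_le_log_exp_one_add (t := 1 / dist x y) (by positivity)
    calc |f x - f y| * |Real.log r|
        ≤ Λ / Real.log (Real.exp 1 + 1 / dist x y) *
            ((K + 1 + δ) * Real.log (Real.exp 1 + 1 / dist x y)) := by
          gcongr
          · exact hf x y
          · exact abs_log_le_mul_log (dist_pos.2 hne) hr hrδ hxy
      _ = Λ * (K + 1 + δ) := by field_simp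

lemma rpow_le {δ K r : ℝ} (hf : HasLogModulus Λ f) (hr : 0 < r) (hrδ : r ≤ δ) {x y : X}
    (hxy : dist x y ≤ K * r) : r ^ f x ≤ oscFactor δ Λ K * r ^ f y := by
  rw [oscFactor, Real.rpow_def_of_pos hr, Real.rpow_def_of_pos hr, ← Real.exp_add,
    Real.exp_le_exp]
  have hosc := hf.abs_mul_log_le hr hrδ hxy
  rw [← abs_mul] at hosc
  linarith [le_abs_self ((f x - f y) * Real.log r)]

lemma mul_rpow_le {δ M τ r : ℝ} (hf : HasLogModulus Λ f) (hτ : 0 < τ) (hr : 0 < r)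
    (hrδ : τ * r ≤ δ) {x x₀ : X} (hM : |f x₀| ≤ M) (hx : dist x x₀ ≤ r) :
    (τ * r) ^ f x ≤ scaleFactor δ Λ M τ * r ^ f x₀ := by
  have hτ_pow : τ ^ f x₀ ≤ Real.exp (M * |Real.log τ|) := by
    rw [Real.rpow_def_of_pos hτ, Real.exp_le_exp, mul_comm]
    refine (le_abs_self _).trans ?_
    rw [abs_mul]
    gcongr
  calc (τ * r) ^ f x ≤ oscFactor δ Λ τ⁻¹ * (τ * r) ^ f x₀ :=
        hf.rpow_le (by positivity) hrδ (by rwa [inv_mul_cancel_left₀ hτ.ne'])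
    _ = oscFactor δ Λ τ⁻¹ * τ ^ f x₀ * r ^ f x₀ := by
        rw [Real.mul_rpow hτ.le hr.le, mul_assoc]
    _ ≤ scaleFactor δ Λ M τ * r ^ f x₀ := by
        rw [scaleFactor]
        gcongr
        exact (oscFactor_pos _ _ _).le

lemma dist_rpow_le {δ K k R r : ℝ} (hf : HasLogModulus Λ f) (hr : 0 < r) (hrδ : r ≤ δ)
    (hk : 1 ≤ k) {w x y z : X} (hf0 : 0 ≤ f w) (hfR : f w ≤ R) (hyz : dist y z ≤ k * r)
    (hwx : dist w x ≤ K * r) : dist y z ^ f w ≤ k ^ R * (oscFactor δ Λ K * r ^ f x) :=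
  calc dist y z ^ f w ≤ (k * r) ^ f w := Real.rpow_le_rpow dist_nonneg hyz hf0
    _ = k ^ f w * r ^ f w := Real.mul_rpow (by positivity) hr.le
    _ ≤ k ^ R * (oscFactor δ Λ K * r ^ f x) := by
        gcongr
        exact hf.rpow_le hr hrδ hwx

lemma neg (hf : HasLogModulus Λ f) : HasLogModulus Λ fun x => -f x := fun x y => by
  simpa only [neg_sub_neg, abs_sub_comm] using hf x y

lemma add (hf : HasLogModulus Λ f) (hg : HasLogModulus Λ' g) :
    HasLogModulus (Λ + Λ') fun x => f x + g x := fun x y => by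
  rw [add_sub_add_comm, add_div]
  exact (abs_add_le _ _).trans (add_le_add (hf x y) (hg x y))

lemma sub (hf : HasLogModulus Λ f) (hg : HasLogModulus Λ' g) :
    HasLogModulus (Λ + Λ') fun x => f x - g x := by
  simpa only [sub_eq_add_neg] using hf.add hg.neg

lemma const_mul {c : ℝ} (hf : HasLogModulus Λ f) (hc : 0 ≤ c) :
    HasLogModulus (c * Λ) fun x => c * f x := fun x y => by
  rw [← mul_sub, abs_mul, abs_of_nonneg hc, mul_div_assoc]
  exact mul_le_mul_of_nonneg_left (hf x y) hc

lemma mono (hf : HasLogModulus Λ f) (h : Λ ≤ Λ') : HasLogModulus Λ' f := fun x y => by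
  have := one_le_log_exp_one_add (t := 1 / dist x y) (by positivity)
  exact (hf x y).trans (by gcongr)

end HasLogModulus

end LogModulus

section Exponent

variable [MetricSpace X] [MeasurableSpace X] {μ : Measure X} {m M L : ℝ} {p q : X → ℝ}

lemma IsMetricMeasure.dense_of_ae (hμ : IsMetricMeasure μ) {P : X → Prop} (h : ∀ᵐ x ∂μ, P x) :
    Dense {x | P x} := by
  intro x
  rw [Metric.mem_closure_iff]
  intro ε hε
  by_contra! hfar
  have hball : Metric.ball x ε ⊆ {y | ¬P y} := fun y hy hP =>
    (hfar y hP).not_gt (Metric.mem_ball'.1 hy)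
  exact (hμ x ε hε).1.ne' (measure_mono_null hball (ae_iff.1 h))

lemma IsMetricMeasure.forall_le_of_ae (hμ : IsMetricMeasure μ) {f g : X → ℝ} (hf : Continuous f)
    (hg : Continuous g) (h : ∀ᵐ x ∂μ, f x ≤ g x) (x : X) : f x ≤ g x := by
  have hx := hμ.dense_of_ae h x
  rwa [(isClosed_le hf hg).closure_eq] at hx

namespace IsLogHolderExponent

lemma continuous (hp : IsLogHolderExponent μ m M L p) : Continuous p := by
  have hinv : HasLogModulus L fun x => 1 / p x := hp.logHolder
  refine (hinv.continuous.inv₀ fun x => (one_div_pos.2 (hp.pos x)).ne').congr fun x => ?_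
  simp only [Pi.inv_apply, one_div, inv_inv]

lemma le_apply (hp : IsLogHolderExponent μ m M L p) (hμ : IsMetricMeasure μ) (x : X) : m ≤ p x :=
  hμ.forall_le_of_ae continuous_const hp.continuous hp.lower x

lemma apply_le (hp : IsLogHolderExponent μ m M L p) (hμ : IsMetricMeasure μ) (x : X) : p x ≤ M :=
  hμ.forall_le_of_ae hp.continuous continuous_const hp.upper x

lemma hasLogModulus (hp : IsLogHolderExponent μ m M L p) (hμ : IsMetricMeasure μ) :
    HasLogModulus (M ^ 2 * L) p := fun x y => by
  have hx := hp.pos x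
  have hy := hp.pos y
  have hxM := hp.apply_le hμ x
  have hsub : p x - p y = p x * p y * -(1 / p x - 1 / p y) := by
    field_simp
    ring
  rw [hsub, abs_mul, abs_neg, abs_of_pos (mul_pos hx hy), mul_div_assoc]
  refine mul_le_mul ?_ (hp.logHolder x y) (abs_nonneg _) (sq_nonneg M)
  rw [sq]
  exact mul_le_mul hxM (hp.apply_le hμ y) hy.le (hx.le.trans hxM)

lemma hasLogModulus_div (hp : IsLogHolderExponent μ m M L p) (hq : IsLogHolderExponent μ m M L q)
    (hμ : IsMetricMeasure μ) (hm : 0 < m) :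
    HasLogModulus (M * L + 1 / m * (M ^ 2 * L)) fun x => q x / p x := fun x y => by
  have hsub : q x / p x - q y / p y = q x * (1 / p x - 1 / p y) + 1 / p y * (q x - q y) := by ring
  have hqM := hq.apply_le hμ x
  rw [hsub, add_div, mul_div_assoc, mul_div_assoc]
  refine (abs_add_le _ _).trans (add_le_add ?_ ?_)
  · rw [abs_mul, abs_of_pos (hq.pos x)]
    exact mul_le_mul hqM (hp.logHolder x y) (abs_nonneg _) ((hq.pos x).le.trans hqM)
  · rw [abs_mul, abs_of_pos (one_div_pos.2 (hp.pos y))]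
    exact mul_le_mul (one_div_le_one_div_of_le hm (hp.le_apply hμ y)) (hq.hasLogModulus hμ x y)
      (abs_nonneg _) (by positivity)

end IsLogHolderExponent

end Exponent

section GradientData

/-- The scale `t ≤ ρ` with `t ^ (-q) = max G (ρ ^ (-q))`, at which the telescoping sum over dyadic
radii is stopped. -/
def scale (q ρ G : ℝ) : ℝ := max G (ρ ^ (-q)) ^ (-q⁻¹)

section Scale

variable {q ρ G : ℝ}

lemma scale_pos (hρ : 0 < ρ) : 0 < scale q ρ G := by
  have : 0 < ρ ^ (-q) := by positivity
  have : 0 < max G (ρ ^ (-q)) := lt_max_of_lt_right this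
  unfold scale
  positivity

lemma scale_rpow_neg (hq : 0 < q) (hρ : 0 < ρ) : scale q ρ G ^ (-q) = max G (ρ ^ (-q)) := by
  have hmax : 0 < max G (ρ ^ (-q)) := lt_max_of_lt_right (by positivity)
  rw [scale, ← Real.rpow_mul hmax.le, neg_mul_neg, inv_mul_cancel₀ hq.ne', Real.rpow_one]

lemma scale_le (hq : 0 < q) (hρ : 0 < ρ) : scale q ρ G ≤ ρ := by
  by_contra! hlt
  have := Real.rpow_lt_rpow_of_neg hρ hlt (neg_neg_of_pos hq)
  rw [scale_rpow_neg hq hρ] at this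
  exact this.not_ge (le_max_right _ _)

lemma scale_rpow_neg_mul_le {p : ℝ} (hq : 0 < q) (hρ : 0 < ρ) (hG : 0 ≤ G) :
    scale q ρ G ^ (-(q * p)) ≤ G ^ p + ρ ^ (-(q * p)) := by
  rw [← neg_mul, Real.rpow_mul (scale_pos hρ).le, scale_rpow_neg hq hρ, Real.rpow_mul hρ.le]
  rcases max_choice G (ρ ^ (-q)) with h | h <;> rw [h]
  · exact le_add_of_nonneg_right (by positivity)
  · exact le_add_of_nonneg_left (by positivity)

lemma exists_dyadic_radius_le {t : ℝ} (ht : 0 < t) (htρ : t ≤ ρ) :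
    ∃ J : ℕ, ρ / 2 ^ J ≤ t ∧ t ≤ 2 * (ρ / 2 ^ J) := by
  obtain ⟨n, hn, hn'⟩ := exists_nat_pow_near ((one_le_div ht).2 htρ) one_lt_two
  rw [le_div_iff₀ ht] at hn
  rw [div_lt_iff₀ ht] at hn'
  refine ⟨n + 1, ?_, ?_⟩
  · rw [div_le_iff₀ (by positivity)]
    linarith
  · rw [pow_succ, ← div_div, mul_div_cancel₀ _ two_ne_zero, le_div_iff₀ (by positivity)]
    linarith

end Scale

/-- `y` is a good point of `S` for the ball `B(x,r)`: it lies in the ball and `G` does not exceed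
`A r^{-q(x)}` there. -/
structure IsGoodPoint [MetricSpace X] (A : ℝ) (S : Set X) (q G : X → ℝ) (x : X) (r : ℝ) (y : X) :
    Prop where
  mem : y ∈ S
  dist_lt : dist y x < r
  le : G y ≤ A * r ^ (-q x)

/-- What the estimates need to know about a Hajłasz pair: `G` is a scalar `s(·)`-gradient of `u` on
the set `S`, and every ball of radius at most `δ` contained in `E` has a good point in `S`. The
number `R` bounds the exponents and `Λ` their logarithmic moduli of continuity. -/
structure GradientData [MetricSpace X] (δ Λ R A : ℝ) (E S : Set X) (s q u G : X → ℝ) : Prop where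
  s_nonneg : ∀ x, 0 ≤ s x
  s_le : ∀ x, s x ≤ R
  q_pos : ∀ x, 0 < q x
  q_le : ∀ x, q x ≤ R
  s_log : HasLogModulus Λ s
  q_log : HasLogModulus Λ q
  G_nonneg : ∀ x, 0 ≤ G x
  gradient : ∀ x ∈ S, ∀ y ∈ S, |u x - u y| ≤ dist x y ^ s x * G x + dist x y ^ s y * G y
  exists_isGoodPoint : ∀ x r, 0 < r → r ≤ δ → Metric.ball x r ⊆ E → ∃ y, IsGoodPoint A S q G x r y

/-- The constant in the comparison of `u` at good points of two balls of the same radius `ρ` with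
centres at distance at most `K ρ`. -/
def linkConst (δ Λ R K A : ℝ) : ℝ :=
  2 * (K + 2) ^ R * oscFactor δ Λ (K + 1) ^ 2 * A

/-- The constant in the telescoping estimate; doubling the radius of a ball multiplies the bound at
its good points by at most `2 ^ R`. -/
def chainConst (δ Λ R A : ℝ) : ℝ := linkConst δ Λ R 0 (2 ^ R * A)

lemma linkConst_nonneg {δ Λ R K A : ℝ} (hK : 0 ≤ K) (hA : 0 ≤ A) : 0 ≤ linkConst δ Λ R K A := by
  unfold linkConst
  positivity

lemma chainConst_nonneg {δ Λ R A : ℝ} (hA : 0 ≤ A) : 0 ≤ chainConst δ Λ R A :=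
  linkConst_nonneg le_rfl (by positivity)

variable [MetricSpace X] {δ Λ R A : ℝ} {E S : Set X} {s q u G : X → ℝ}

namespace IsGoodPoint

variable {x y : X} {r ρ : ℝ}

lemma radius_pos (hy : IsGoodPoint A S q G x r y) : 0 < r := dist_nonneg.trans_lt hy.dist_lt

lemma const_nonneg (hy : IsGoodPoint A S q G x r y) (hG : 0 ≤ G y) : 0 ≤ A :=
  nonneg_of_mul_nonneg_left (hG.trans hy.le) (Real.rpow_pos_of_pos hy.radius_pos _)

lemma mono {A' : ℝ} (hy : IsGoodPoint A S q G x r y) (hA : A ≤ A') :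
    IsGoodPoint A' S q G x r y :=
  ⟨hy.mem, hy.dist_lt,
    hy.le.trans (mul_le_mul_of_nonneg_right hA (Real.rpow_nonneg hy.radius_pos.le _))⟩

lemma double_radius (hy : IsGoodPoint A S q G x (r / 2) y) (hA : 0 ≤ A) (hq : q x ≤ R) :
    IsGoodPoint (2 ^ R * A) S q G x r y := by
  have hr : 0 < r := by linarith [hy.radius_pos]
  refine ⟨hy.mem, by linarith [hy.dist_lt], hy.le.trans ?_⟩
  calc A * (r / 2) ^ (-q x) = A * (2 ^ q x * r ^ (-q x)) := by
        rw [Real.div_rpow hr.le zero_le_two, Real.rpow_neg zero_le_two, div_inv_eq_mul, mul_comm _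
          (2 ^ q x)]
    _ ≤ A * (2 ^ R * r ^ (-q x)) := by
        gcongr
        exact one_le_two
    _ = 2 ^ R * A * r ^ (-q x) := by ring

end IsGoodPoint

namespace GradientData

lemma const_nonneg (h : GradientData δ Λ R A E S s q u G) {x y : X} {r : ℝ}
    (hy : IsGoodPoint A S q G x r y) : 0 ≤ A :=
  hy.const_nonneg (h.G_nonneg y)

lemma abs_sub_le_of_isGoodPoint (h : GradientData δ Λ R A E S s q u G) {A' K ρ : ℝ} (hρδ : ρ ≤ δ)
    {x x' y z : X} (hxx' : dist x x' ≤ K * ρ) (hy : IsGoodPoint A' S q G x ρ y)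
    (hz : IsGoodPoint A' S q G x' ρ z) :
    |u y - u z| ≤ linkConst δ Λ R K A' * ρ ^ (s x - q x) := by
  have hρ := hy.radius_pos
  have hA' : 0 ≤ A' := hy.const_nonneg (h.G_nonneg y)
  have hK : 0 ≤ K := nonneg_of_mul_nonneg_left (dist_nonneg.trans hxx') hρ
  set W := oscFactor δ Λ (K + 1) with hW
  have hW1 : 1 ≤ W := one_le_oscFactor (hρ.le.trans hρδ) (h.s_log.nonneg x) (by positivity)
  have hyx : dist y x ≤ (K + 1) * ρ := by nlinarith [hy.dist_lt]
  have hzx : dist z x ≤ (K + 1) * ρ := by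
    linarith [dist_triangle_right z x x', hz.dist_lt]
  have hyz : dist y z ≤ (K + 2) * ρ := by linarith [dist_triangle_right y z x, hy.dist_lt]
  have hdist : ∀ w, dist w x ≤ (K + 1) * ρ → dist y z ^ s w ≤ (K + 2) ^ R * (W * ρ ^ s x) :=
    fun w hw => h.s_log.dist_rpow_le hρ hρδ (by linarith) (h.s_nonneg w) (h.s_le w) hyz hw
  have hGy : G y ≤ A' * (W * ρ ^ (-q x)) :=
    hy.le.trans (by gcongr; exact le_mul_of_one_le_left (by positivity) hW1)
  have hGz : G z ≤ A' * (W * ρ ^ (-q x)) := by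
    refine hz.le.trans (mul_le_mul_of_nonneg_left (h.q_log.neg.rpow_le hρ hρδ ?_) hA')
    rw [dist_comm]
    linarith
  calc |u y - u z| ≤ dist y z ^ s y * G y + dist y z ^ s z * G z := h.gradient y hy.mem z hz.mem
    _ ≤ (K + 2) ^ R * (W * ρ ^ s x) * (A' * (W * ρ ^ (-q x))) +
        (K + 2) ^ R * (W * ρ ^ s x) * (A' * (W * ρ ^ (-q x))) := by
      gcongr
      exacts [h.G_nonneg y, hdist y hyx, h.G_nonneg z, hdist z hzx]
    _ = linkConst δ Λ R K A' * ρ ^ (s x - q x) := by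
      rw [linkConst, ← hW, Real.rpow_sub hρ, Real.rpow_neg hρ.le]
      ring

lemma abs_sub_le_of_isGoodPoint_self (h : GradientData δ Λ R A E S s q u G) {x y : X} {ρ : ℝ}
    (hρδ : ρ ≤ δ) (hx : x ∈ S) (hy : IsGoodPoint A S q G x ρ y) :
    |u x - u y| ≤ ρ ^ s x * G x + chainConst δ Λ R A * ρ ^ (s x - q x) := by
  have hρ := hy.radius_pos
  have hA := h.const_nonneg hy
  have hW1 : 1 ≤ oscFactor δ Λ (0 + 1) :=
    one_le_oscFactor (hρ.le.trans hρδ) (h.s_log.nonneg x) (by norm_num)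
  have hR : (1 : ℝ) ≤ 2 ^ R :=
    Real.one_le_rpow one_le_two ((h.s_nonneg x).trans (h.s_le x))
  have hdist : dist x y ^ s y ≤ oscFactor δ Λ (0 + 1) * ρ ^ s x :=
    (Real.rpow_le_rpow dist_nonneg (dist_comm x y ▸ hy.dist_lt.le) (h.s_nonneg y)).trans
      (h.s_log.rpow_le hρ hρδ (by linarith [hy.dist_lt]))
  have hC : oscFactor δ Λ (0 + 1) * A ≤ chainConst δ Λ R A := by
    calc oscFactor δ Λ (0 + 1) * A = 1 * 1 * (oscFactor δ Λ (0 + 1) * 1) * (1 * A) := by ring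
      _ ≤ 2 * (0 + 2) ^ R * (oscFactor δ Λ (0 + 1) * oscFactor δ Λ (0 + 1)) * (2 ^ R * A) := by
        rw [zero_add (2 : ℝ)]
        gcongr
        exact one_le_two
      _ = chainConst δ Λ R A := by rw [chainConst, linkConst, sq]
  calc |u x - u y| ≤ dist x y ^ s x * G x + dist x y ^ s y * G y := h.gradient x hx y hy.mem
    _ ≤ ρ ^ s x * G x + oscFactor δ Λ (0 + 1) * ρ ^ s x * (A * ρ ^ (-q x)) := by
      gcongr
      exacts [h.G_nonneg x, h.s_nonneg x, dist_comm x y ▸ hy.dist_lt.le, h.G_nonneg y, hy.le]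
    _ = ρ ^ s x * G x + oscFactor δ Λ (0 + 1) * A * ρ ^ (s x - q x) := by
      rw [Real.rpow_sub hρ, Real.rpow_neg hρ.le]
      ring
    _ ≤ ρ ^ s x * G x + chainConst δ Λ R A * ρ ^ (s x - q x) := by gcongr

lemma exists_isGoodPoint_abs_sub_le_sum (h : GradientData δ Λ R A E S s q u G) {x : X}
    (hx : x ∈ S) {ρ : ℝ} (hρ : 0 < ρ) (hρδ : ρ ≤ δ) (hball : Metric.ball x ρ ⊆ E) (J : ℕ) :
    ∃ y, IsGoodPoint A S q G x ρ y ∧ |u x - u y| ≤ (ρ / 2 ^ J) ^ s x * G x +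
      chainConst δ Λ R A * ∑ j ∈ Finset.range (J + 1), (ρ / 2 ^ j) ^ (s x - q x) := by
  have hle (j : ℕ) : ρ / 2 ^ j ≤ ρ := div_le_self hρ.le (one_le_pow₀ one_le_two)
  have hgood (j : ℕ) : ∃ y, IsGoodPoint A S q G x (ρ / 2 ^ j) y :=
    h.exists_isGoodPoint x _ (by positivity) ((hle j).trans hρδ)
      ((Metric.ball_subset_ball (hle j)).trans hball)
  choose y hy using hgood
  have hA := h.const_nonneg (hy 0)
  have hR : (1 : ℝ) ≤ 2 ^ R :=
    Real.one_le_rpow one_le_two ((h.s_nonneg x).trans (h.s_le x))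
  have hstep (j : ℕ) :
      dist (u (y j)) (u (y (j + 1))) ≤ chainConst δ Λ R A * (ρ / 2 ^ j) ^ (s x - q x) := by
    refine h.abs_sub_le_of_isGoodPoint ((hle j).trans hρδ) (x' := x) (by simp)
      ((hy j).mono (le_mul_of_one_le_left hA hR)) ?_
    refine IsGoodPoint.double_radius ?_ hA (h.q_le x)
    rw [div_div, ← pow_succ]
    exact hy (j + 1)
  have htele := dist_le_range_sum_of_dist_le J fun {j} _ => hstep j
  have hlast := h.abs_sub_le_of_isGoodPoint_self ((hle J).trans hρδ) hx (hy J)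
  refine ⟨y 0, by simpa only [pow_zero, div_one] using hy 0, ?_⟩
  rw [Finset.sum_range_succ, mul_add, Finset.mul_sum]
  rw [Real.dist_eq, abs_sub_comm] at htele
  linarith [abs_sub_le (u x) (u (y J)) (u (y 0))]

/-- At the scale `t` of the definition, `t ^ s * G ≤ t ^ (s - q)`, so the endpoint of the chain
costs no more than one further term of the sum. -/
lemma exists_isGoodPoint_abs_sub_le_scale (h : GradientData δ Λ R A E S s q u G) {x : X}
    (hx : x ∈ S) {ρ : ℝ} (hρ : 0 < ρ) (hρδ : ρ ≤ δ) (hball : Metric.ball x ρ ⊆ E) :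
    ∃ (J : ℕ) (y : X), ρ / 2 ^ J ≤ scale (q x) ρ (G x) ∧ scale (q x) ρ (G x) ≤ 2 * (ρ / 2 ^ J) ∧
      IsGoodPoint A S q G x ρ y ∧ |u x - u y| ≤ scale (q x) ρ (G x) ^ (s x - q x) +
        chainConst δ Λ R A * ∑ j ∈ Finset.range (J + 1), (ρ / 2 ^ j) ^ (s x - q x) := by
  have ht : 0 < scale (q x) ρ (G x) := scale_pos hρ
  obtain ⟨J, hJ, hJ'⟩ := exists_dyadic_radius_le ht (scale_le (h.q_pos x) hρ)
  obtain ⟨y, hy, hxy⟩ := h.exists_isGoodPoint_abs_sub_le_sum hx hρ hρδ hball J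
  refine ⟨J, y, hJ, hJ', hy, hxy.trans ?_⟩
  rw [sub_eq_add_neg, Real.rpow_add ht, scale_rpow_neg (h.q_pos x) hρ]
  gcongr
  · exact h.G_nonneg x
  · exact h.s_nonneg x
  · exact le_max_left _ _

end GradientData

end GradientData

section GeometricSum

/-- The sum of the geometric series with ratio `2 ^ (-a)`. -/
def geomSum (a : ℝ) : ℝ := ∑' j : ℕ, ((2 : ℝ) ^ (-a)) ^ j

lemma geomSum_nonneg (a : ℝ) : 0 ≤ geomSum a := tsum_nonneg fun _ => by positivity

lemma sum_div_two_pow_rpow_le {ρ a a₀ : ℝ} (hρ : 0 < ρ) (ha₀ : 0 < a₀) (ha : a₀ ≤ a) (n : ℕ) :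
    ∑ j ∈ Finset.range n, (ρ / 2 ^ j) ^ a ≤ geomSum a₀ * ρ ^ a := by
  have hterm (j : ℕ) : (ρ / 2 ^ j) ^ a ≤ ((2 : ℝ) ^ (-a₀)) ^ j * ρ ^ a := by
    rw [Real.div_rpow hρ.le (by positivity), div_eq_mul_inv, mul_comm, Real.rpow_pow_comm
      zero_le_two, Real.rpow_neg (by positivity)]
    gcongr
    exact one_le_pow₀ one_le_two
  have hratio : (2 : ℝ) ^ (-a₀) < 1 := Real.rpow_lt_one_of_one_lt_of_neg one_lt_two (by linarith)
  calc ∑ j ∈ Finset.range n, (ρ / 2 ^ j) ^ a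
      ≤ ∑ j ∈ Finset.range n, ((2 : ℝ) ^ (-a₀)) ^ j * ρ ^ a :=
        Finset.sum_le_sum fun j _ => hterm j
    _ = (∑ j ∈ Finset.range n, ((2 : ℝ) ^ (-a₀)) ^ j) * ρ ^ a := by rw [Finset.sum_mul]
    _ ≤ geomSum a₀ * ρ ^ a := by
        gcongr
        exact (summable_geometric_of_lt_one (by positivity) hratio).sum_le_tsum _
          fun j _ => by positivity

/-- For a negative exponent the sum is governed by its last term; read backwards it has the form
treated in `sum_div_two_pow_rpow_le`. -/
lemma sum_div_two_pow_rpow_le_of_le_neg {ρ a a₀ : ℝ} (hρ : 0 < ρ) (ha₀ : 0 < a₀) (ha : a ≤ -a₀)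
    (J : ℕ) :
    ∑ j ∈ Finset.range (J + 1), (ρ / 2 ^ j) ^ a ≤ geomSum a₀ * (ρ / 2 ^ J) ^ a := by
  have hinv {t : ℝ} (ht : 0 < t) : t ^ a = t⁻¹ ^ (-a) := by
    rw [Real.inv_rpow ht.le, Real.rpow_neg ht.le, inv_inv]
  rw [← Finset.sum_range_reflect, hinv (by positivity)]
  refine (Finset.sum_congr rfl fun j hj => ?_).trans_le
    (sum_div_two_pow_rpow_le (by positivity) ha₀ (le_neg_of_le_neg ha) (J + 1))
  have hj' : j ≤ J := Nat.lt_succ_iff.1 (Finset.mem_range.1 hj)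
  rw [Nat.add_sub_cancel, hinv (by positivity), ← pow_sub_mul_pow (2 : ℝ) hj']
  congr 1
  field_simp

end GeometricSum

section PointwiseEstimates

/-- The constant in the comparison of `u x` with its values at good points, for an exponent `s - q`
at distance at least `a₀` from zero. -/
def approachConst (δ Λ R A a₀ : ℝ) : ℝ := 1 + chainConst δ Λ R A * (geomSum a₀ * 2 ^ R)

/-- The constant in the pointwise estimate in the subcritical case. -/
def subcriticalConst (δ Λ R A K a₀ : ℝ) : ℝ := approachConst δ Λ R A a₀ + linkConst δ Λ R K A

/-- The constant in the pointwise estimate in the critical case. -/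
def criticalConst (δ Λ R A K : ℝ) : ℝ := 1 + chainConst δ Λ R A + linkConst δ Λ R K A

/-- The constant in the pointwise Hölder estimate in the supercritical case. -/
def supercriticalConst (δ Λ R A K a₀ : ℝ) : ℝ :=
  approachConst δ Λ R A a₀ * (1 + oscFactor δ (Λ + Λ) K) + linkConst δ Λ R K A

section Positivity

variable {δ Λ R A K a₀ : ℝ}

lemma approachConst_pos (hA : 0 ≤ A) : 0 < approachConst δ Λ R A a₀ := by
  have := chainConst_nonneg (δ := δ) (Λ := Λ) (R := R) hA
  have := geomSum_nonneg a₀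
  unfold approachConst
  positivity

lemma subcriticalConst_pos (hK : 0 ≤ K) (hA : 0 ≤ A) : 0 < subcriticalConst δ Λ R A K a₀ :=
  add_pos_of_pos_of_nonneg (approachConst_pos hA) (linkConst_nonneg hK hA)

lemma criticalConst_pos (hK : 0 ≤ K) (hA : 0 ≤ A) : 0 < criticalConst δ Λ R A K :=
  add_pos_of_pos_of_nonneg (add_pos_of_pos_of_nonneg one_pos (chainConst_nonneg hA))
    (linkConst_nonneg hK hA)

lemma supercriticalConst_pos (hK : 0 ≤ K) (hA : 0 ≤ A) : 0 < supercriticalConst δ Λ R A K a₀ :=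
  add_pos_of_pos_of_nonneg
    (mul_pos (approachConst_pos hA) (add_pos one_pos (oscFactor_pos _ _ _)))
    (linkConst_nonneg hK hA)

end Positivity

namespace GradientData

variable [MetricSpace X] {δ Λ R A K a₀ ρ : ℝ} {E S : Set X} {s q u G : X → ℝ} {x x₀ y z : X}

lemma exists_isGoodPoint_of_subcritical (h : GradientData δ Λ R A E S s q u G) (ha₀ : 0 < a₀)
    (hα : s x - q x ≤ -a₀) (hρ : 0 < ρ) (hρδ : ρ ≤ δ) (hx : x ∈ S) (hball : Metric.ball x ρ ⊆ E) :
    ∃ y, IsGoodPoint A S q G x ρ y ∧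
      |u x - u y| ≤ approachConst δ Λ R A a₀ * scale (q x) ρ (G x) ^ (s x - q x) := by
  obtain ⟨J, y, -, hJ, hy, hxy⟩ := h.exists_isGoodPoint_abs_sub_le_scale hx hρ hρδ hball
  set t := scale (q x) ρ (G x)
  have ht : 0 < t := scale_pos hρ
  have hA := chainConst_nonneg (δ := δ) (Λ := Λ) (R := R) (h.const_nonneg hy)
  have hlast : (ρ / 2 ^ J) ^ (s x - q x) ≤ 2 ^ R * t ^ (s x - q x) :=
    calc (ρ / 2 ^ J) ^ (s x - q x) ≤ (t / 2) ^ (s x - q x) :=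
          Real.rpow_le_rpow_of_nonpos (by positivity) (by linarith) (by linarith)
      _ = 2 ^ (-(s x - q x)) * t ^ (s x - q x) := by
          rw [Real.div_rpow ht.le zero_le_two, Real.rpow_neg zero_le_two]
          field_simp
      _ ≤ 2 ^ R * t ^ (s x - q x) := by
          gcongr
          · exact one_le_two
          · linarith [h.q_le x, h.s_nonneg x]
  refine ⟨y, hy, hxy.trans ?_⟩
  calc t ^ (s x - q x) +
        chainConst δ Λ R A * ∑ j ∈ Finset.range (J + 1), (ρ / 2 ^ j) ^ (s x - q x)
      ≤ t ^ (s x - q x) +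
        chainConst δ Λ R A * (geomSum a₀ * (2 ^ R * t ^ (s x - q x))) := by
        gcongr
        refine (sum_div_two_pow_rpow_le_of_le_neg hρ ha₀ hα J).trans ?_
        have := geomSum_nonneg a₀
        gcongr
    _ = approachConst δ Λ R A a₀ * t ^ (s x - q x) := by
        rw [approachConst]
        ring

lemma exists_isGoodPoint_of_supercritical (h : GradientData δ Λ R A E S s q u G) (ha₀ : 0 < a₀)
    (hα : a₀ ≤ s x - q x) (hρ : 0 < ρ) (hρδ : ρ ≤ δ) (hx : x ∈ S) (hball : Metric.ball x ρ ⊆ E) :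
    ∃ y, IsGoodPoint A S q G x ρ y ∧
      |u x - u y| ≤ approachConst δ Λ R A a₀ * ρ ^ (s x - q x) := by
  obtain ⟨J, y, -, -, hy, hxy⟩ := h.exists_isGoodPoint_abs_sub_le_scale hx hρ hρδ hball
  have hA := chainConst_nonneg (δ := δ) (Λ := Λ) (R := R) (h.const_nonneg hy)
  have hgeom := geomSum_nonneg a₀
  have hR : (1 : ℝ) ≤ 2 ^ R :=
    Real.one_le_rpow one_le_two ((h.s_nonneg x).trans (h.s_le x))
  refine ⟨y, hy, hxy.trans ?_⟩
  calc scale (q x) ρ (G x) ^ (s x - q x) +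
        chainConst δ Λ R A * ∑ j ∈ Finset.range (J + 1), (ρ / 2 ^ j) ^ (s x - q x)
      ≤ ρ ^ (s x - q x) + chainConst δ Λ R A * (geomSum a₀ * 2 ^ R * ρ ^ (s x - q x)) := by
        gcongr ?_ + chainConst δ Λ R A * ?_
        · exact Real.rpow_le_rpow (scale_pos hρ).le (scale_le (h.q_pos x) hρ) (ha₀.le.trans hα)
        · refine (sum_div_two_pow_rpow_le hρ ha₀ hα (J + 1)).trans ?_
          gcongr
          exact le_mul_of_one_le_right hgeom hR
    _ = approachConst δ Λ R A a₀ * ρ ^ (s x - q x) := by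
        rw [approachConst]
        ring

lemma abs_sub_le_of_subcritical (h : GradientData δ Λ R A E S s q u G) (ha₀ : 0 < a₀)
    (hα : s x - q x ≤ -a₀) (hρδ : ρ ≤ δ) (hx : x ∈ S) (hball : Metric.ball x ρ ⊆ E)
    (hxx₀ : dist x x₀ ≤ K * ρ) (hz : IsGoodPoint A S q G x₀ ρ z) :
    |u x - u z| ≤ subcriticalConst δ Λ R A K a₀ * scale (q x) ρ (G x) ^ (s x - q x) := by
  have hρ := hz.radius_pos
  obtain ⟨y, hy, hxy⟩ := h.exists_isGoodPoint_of_subcritical ha₀ hα hρ hρδ hx hball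
  have hK : 0 ≤ K := nonneg_of_mul_nonneg_left (dist_nonneg.trans hxx₀) hρ
  have hlink : |u y - u z| ≤ linkConst δ Λ R K A * scale (q x) ρ (G x) ^ (s x - q x) :=
    (h.abs_sub_le_of_isGoodPoint hρδ hxx₀ hy hz).trans <|
      mul_le_mul_of_nonneg_left
        (Real.rpow_le_rpow_of_nonpos (scale_pos hρ) (scale_le (h.q_pos x) hρ) (by linarith))
        (linkConst_nonneg hK (h.const_nonneg hy))
  rw [subcriticalConst, add_mul]
  exact (abs_sub_le _ (u y) _).trans (add_le_add hxy hlink)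

/-- In the critical case all terms of the telescoping sum are equal to one, and their number is the
logarithm of the ratio of the first and the last radius. -/
lemma abs_sub_le_of_critical (h : GradientData δ Λ R A E S s q u G) (hα : s x = q x)
    (hρδ : ρ ≤ δ) (hx : x ∈ S) (hball : Metric.ball x ρ ⊆ E) (hxx₀ : dist x x₀ ≤ K * ρ)
    (hz : IsGoodPoint A S q G x₀ ρ z) :
    |u x - u z| ≤ criticalConst δ Λ R A K * Real.logb 2 (4 * (ρ / scale (q x) ρ (G x))) := by
  have hρ := hz.radius_pos
  have ht : 0 < scale (q x) ρ (G x) := scale_pos hρ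
  obtain ⟨J, y, -, hJ, hy, hxy⟩ := h.exists_isGoodPoint_abs_sub_le_scale hx hρ hρδ hball
  have hlink := h.abs_sub_le_of_isGoodPoint hρδ hxx₀ hy hz
  simp only [hα, sub_self, Real.rpow_zero, Finset.sum_const, Finset.card_range, nsmul_eq_mul,
    mul_one, Nat.cast_add, Nat.cast_one] at hxy hlink
  have hK : 0 ≤ K := nonneg_of_mul_nonneg_left (dist_nonneg.trans hxx₀) hρ
  have hlinkConst : 0 ≤ linkConst δ Λ R K A := linkConst_nonneg hK (h.const_nonneg hy)
  have hJ_log : (J : ℝ) + 1 ≤ Real.logb 2 (4 * (ρ / scale (q x) ρ (G x))) := by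
    rw [Real.le_logb_iff_rpow_le one_lt_two (by positivity), ← Nat.cast_add_one,
      Real.rpow_natCast, pow_succ, ← mul_div_assoc, le_div_iff₀ ht]
    rw [← mul_div_assoc, le_div_iff₀ (by positivity)] at hJ
    linarith
  calc |u x - u z| ≤ |u x - u y| + |u y - u z| := abs_sub_le _ _ _
    _ ≤ criticalConst δ Λ R A K * (J + 1) := by
      unfold criticalConst
      nlinarith [mul_nonneg hlinkConst J.cast_nonneg]
    _ ≤ criticalConst δ Λ R A K * Real.logb 2 (4 * (ρ / scale (q x) ρ (G x))) := by
      gcongr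
      exact (criticalConst_pos hK (h.const_nonneg hy)).le

lemma abs_sub_le_of_supercritical (h : GradientData δ Λ R A E S s q u G) {τ : ℝ} (hτ : 0 < τ)
    (hτ1 : τ ≤ 1) (ha₀ : 0 < a₀) (hα : ∀ x, a₀ ≤ s x - q x) (hx : x ∈ S) (hy : y ∈ S)
    (hdδ : τ * dist x y ≤ δ) (hxE : Metric.ball x (τ * dist x y) ⊆ E)
    (hyE : Metric.ball y (τ * dist x y) ⊆ E) :
    |u x - u y| ≤ supercriticalConst δ Λ R A τ⁻¹ a₀ * dist x y ^ (s x - q x) := by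
  rcases eq_or_ne x y with rfl | hne
  · simp [Real.zero_rpow (ha₀.trans_le (hα x)).ne']
  have hd : 0 < dist x y := dist_pos.2 hne
  set ρ := τ * dist x y
  have hρ : 0 < ρ := by positivity
  have hxy : dist x y ≤ τ⁻¹ * ρ := (inv_mul_cancel_left₀ hτ.ne' _).ge
  obtain ⟨x', hx', hxx'⟩ := h.exists_isGoodPoint_of_supercritical ha₀ (hα x) hρ hdδ hx hxE
  obtain ⟨y', hy', hyy'⟩ := h.exists_isGoodPoint_of_supercritical ha₀ (hα y) hρ hdδ hy hyE
  have hlink := h.abs_sub_le_of_isGoodPoint hdδ hxy hx' hy'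
  have hA := h.const_nonneg hx'
  have hosc : ρ ^ (s y - q y) ≤ oscFactor δ (Λ + Λ) τ⁻¹ * ρ ^ (s x - q x) :=
    (h.s_log.sub h.q_log).rpow_le hρ hdδ (dist_comm x y ▸ hxy)
  have hC := approachConst_pos (δ := δ) (Λ := Λ) (R := R) (a₀ := a₀) hA
  calc |u x - u y| ≤ |u x - u x'| + (|u x' - u y'| + |u y - u y'|) := by
        rw [abs_sub_comm (u y)]
        exact (abs_sub_le _ _ _).trans (add_le_add_right (abs_sub_le _ _ _) _)
    _ ≤ approachConst δ Λ R A a₀ * ρ ^ (s x - q x) +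
        (linkConst δ Λ R τ⁻¹ A * ρ ^ (s x - q x) +
          approachConst δ Λ R A a₀ * (oscFactor δ (Λ + Λ) τ⁻¹ * ρ ^ (s x - q x))) := by
        gcongr
        exact hyy'.trans (by gcongr)
    _ = supercriticalConst δ Λ R A τ⁻¹ a₀ * ρ ^ (s x - q x) := by
        rw [supercriticalConst]
        ring
    _ ≤ supercriticalConst δ Λ R A τ⁻¹ a₀ * dist x y ^ (s x - q x) := by
        gcongr
        · exact (supercriticalConst_pos (by positivity) hA).le
        · exact ha₀.le.trans (hα x)
        · exact mul_le_of_le_one_left hd.le hτ1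

end GradientData

end PointwiseEstimates

section Luxemburg

variable [MeasurableSpace X] {μ : Measure X} {p : X → ℝ} {f : X → ℝ≥0∞}

lemma modular_div_le_one_of_luxNorm_lt (hp : ∀ x, 0 ≤ p x) {l : ℝ≥0∞} (h : luxNorm μ p f < l) :
    modular μ p (fun x => f x / l) ≤ 1 := by
  obtain ⟨k, ⟨-, -, hk⟩, hkl⟩ := sInf_lt_iff.1 h
  exact (lintegral_mono fun x =>
    ENNReal.rpow_le_rpow (ENNReal.div_le_div_left hkl.le _) (hp x)).trans hk

lemma luxNorm_le_of_modular_le_one {l : ℝ≥0∞} (h0 : l ≠ 0) (ht : l ≠ ∞)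
    (h : modular μ p (fun x => f x / l) ≤ 1) : luxNorm μ p f ≤ l :=
  sInf_le ⟨h0, ht, h⟩

lemma lintegral_rpow_toReal_div_le_one_of_luxNorm_lt (hp : ∀ x, 0 ≤ p x) {l : ℝ}
    (h : luxNorm μ p f < ENNReal.ofReal l) :
    ∫⁻ x, ENNReal.ofReal (((f x).toReal / l) ^ p x) ∂μ ≤ 1 := by
  have hl : 0 < l := ENNReal.ofReal_pos.1 (bot_le.trans_lt h)
  refine (lintegral_mono fun x => ?_).trans (modular_div_le_one_of_luxNorm_lt hp h)
  dsimp only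
  rw [← ENNReal.ofReal_rpow_of_nonneg (by positivity) (hp x), ENNReal.ofReal_div_of_pos hl]
  exact ENNReal.rpow_le_rpow (ENNReal.div_le_div_right ENNReal.ofReal_toReal_le _) (hp x)

/-- If `I` is the modular of `f`, the modular of `f / (1 + I) ^ (1 / m)` is at most
`I / (1 + I)`. -/
lemma luxNorm_lt_top {m : ℝ} (hm : 0 < m) (hp : ∀ x, m ≤ p x) (h : modular μ p f < ∞) :
    luxNorm μ p f < ∞ := by
  have hI : (1 : ℝ≥0∞) ≤ 1 + modular μ p f := le_self_add
  have hI_top : 1 + modular μ p f ≠ ∞ := ENNReal.add_ne_top.2 ⟨ENNReal.one_ne_top, h.ne⟩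
  set l : ℝ≥0∞ := (1 + modular μ p f) ^ m⁻¹
  have hl : 1 ≤ l := ENNReal.one_le_rpow hI (by positivity)
  have hl_top : l ≠ ∞ := ENNReal.rpow_ne_top_of_nonneg (by positivity) hI_top
  have hlm : l ^ m = 1 + modular μ p f := ENNReal.rpow_inv_rpow hm.ne' _
  have hpt (x : X) : (f x / l) ^ p x ≤ (1 + modular μ p f)⁻¹ * f x ^ p x := by
    rw [ENNReal.div_rpow_of_nonneg _ _ (hm.le.trans (hp x)), div_eq_mul_inv, mul_comm, ← hlm]
    gcongr
    exact hp x
  refine (luxNorm_le_of_modular_le_one (one_pos.trans_le hl).ne' hl_top ?_).trans_lt hl_top.lt_top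
  calc modular μ p (fun x => f x / l)
      ≤ ∫⁻ x, (1 + modular μ p f)⁻¹ * f x ^ p x ∂μ := lintegral_mono hpt
    _ = (1 + modular μ p f)⁻¹ * modular μ p f := by
        rw [lintegral_const_mul' _ _ (ENNReal.inv_ne_top.2 (one_pos.trans_le hI).ne'), modular]
    _ ≤ (1 + modular μ p f)⁻¹ * (1 + modular μ p f) := by
        gcongr
        exact le_add_self
    _ = 1 := ENNReal.inv_mul_cancel (one_pos.trans_le hI).ne' hI_top

lemma MemLpVar.ae_ne_top (hf : MemLpVar μ p f) (hp : Measurable p) (hp0 : ∀ x, 0 < p x) :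
    ∀ᵐ x ∂μ, f x ≠ ∞ := by
  filter_upwards [ae_lt_top' (hf.1.pow hp.aemeasurable) hf.2.ne] with x hx htop
  rw [htop, ENNReal.top_rpow_of_pos (hp0 x)] at hx
  exact hx.ne rfl

lemma exists_mem_le_inv_of_setLIntegral_le_one {B S : Set X} (hB : MeasurableSet B)
    (hB0 : μ B ≠ 0) (hB_top : μ B ≠ ∞) (hS : ∀ᵐ x ∂μ.restrict B, x ∈ S)
    (hf : AEMeasurable f (μ.restrict B)) (hint : ∫⁻ x in B, f x ∂μ ≤ 1) :
    ∃ y ∈ S, y ∈ B ∧ f y ≤ (μ B)⁻¹ := by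
  have : IsFiniteMeasure (μ.restrict B) := ⟨by simpa using hB_top.lt_top⟩
  have hnull : μ.restrict B {y | ¬(y ∈ S ∧ y ∈ B)} = 0 := by
    rw [← ae_iff]
    exact hS.and (ae_restrict_mem hB)
  obtain ⟨y, hy, hle⟩ := exists_notMem_null_le_laverage
    (fun h0 => hB0 (Measure.restrict_eq_zero.1 h0)) hf hnull
  obtain ⟨hyS, hyB⟩ := not_not.1 hy
  refine ⟨y, hyS, hyB, hle.trans ?_⟩
  rw [setLAverage_eq, div_eq_mul_inv]
  exact mul_le_of_le_one_left' hint

end Luxemburg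

section Extraction

/-- A common logarithmic modulus constant of `s` and of `Q / p`. -/
def modulusConst (m M L : ℝ) : ℝ := M ^ 2 * L + (M * L + 1 / m * (M ^ 2 * L))

/-- A common upper bound of `s` and of `Q / p`. -/
def exponentBound (m M : ℝ) : ℝ := M + M / m

/-- The constant in the bound at good points given by the lower bound on the measure of balls. -/
def goodConst (b δ m M L : ℝ) : ℝ := b ^ (-(1 / m)) * oscFactor δ (M * L) 1

lemma goodConst_pos {b : ℝ} (hb : 0 < b) (δ m M L : ℝ) : 0 < goodConst b δ m M L :=
  mul_pos (by positivity) (oscFactor_pos _ _ _)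

variable [MetricSpace X] [MeasurableSpace X] {μ : Measure X} {b δ m M L : ℝ} {Q p s : X → ℝ}

namespace Admissible

lemma bound_pos (h : Admissible b δ m M L μ Q p s) (x : X) : 0 < M :=
  (h.dimension.pos x).trans_le (h.dimension.apply_le h.metricMeasure x)

lemma modulus_nonneg (h : Admissible b δ m M L μ Q p s) (x : X) : 0 ≤ L :=
  HasLogModulus.nonneg (f := fun x => 1 / p x) h.integrability.logHolder x

lemma inv_rpow_inv_le (h : Admissible b δ m M L μ Q p s) (hb : 0 < b) (hb1 : b ≤ 1) (hm : 0 < m)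
    {x y : X} {r : ℝ} (hr : 0 < r) (hrδ : r ≤ δ) (hyx : dist y x < r) :
    (b * r ^ Q x)⁻¹ ^ (p y)⁻¹ ≤ goodConst b δ m M L * r ^ (-(Q x / p x)) := by
  have hlog : HasLogModulus (M * L) fun z => -(Q x * (1 / p z)) :=
    (HasLogModulus.const_mul (f := fun z => 1 / p z) h.integrability.logHolder
      (h.dimension.pos x).le).neg.mono
      (mul_le_mul_of_nonneg_right (h.dimension.apply_le h.metricMeasure x) (h.modulus_nonneg x))
  have hosc := hlog.rpow_le hr hrδ (hyx.le.trans_eq (one_mul r).symm)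
  simp only [mul_one_div] at hosc
  calc (b * r ^ Q x)⁻¹ ^ (p y)⁻¹ = b ^ (-(1 / p y)) * r ^ (-(Q x / p y)) := by
        rw [Real.inv_rpow (by positivity), Real.mul_rpow hb.le (by positivity), mul_inv,
          Real.rpow_neg hb.le, Real.rpow_neg hr.le, ← Real.rpow_mul hr.le, one_div,
          div_eq_mul_inv]
    _ ≤ b ^ (-(1 / m)) * (oscFactor δ (M * L) 1 * r ^ (-(Q x / p x))) := by
        gcongr ?_ * ?_
        refine Real.rpow_le_rpow_of_exponent_ge hb hb1 (neg_le_neg ?_)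
        exact one_div_le_one_div_of_le hm (h.integrability.le_apply h.metricMeasure y)
    _ = goodConst b δ m M L * r ^ (-(Q x / p x)) := (mul_assoc _ _ _).symm

lemma hasLogModulus_smoothness (h : Admissible b δ m M L μ Q p s) (hm : 0 < m) :
    HasLogModulus (modulusConst m M L) s := fun x y => by
  have hM := (h.bound_pos x).le
  have hL := h.modulus_nonneg x
  refine (h.smoothness.hasLogModulus h.metricMeasure).mono ?_ x y
  exact le_add_of_nonneg_right (by positivity)

lemma hasLogModulus_div (h : Admissible b δ m M L μ Q p s) (hm : 0 < m) :
    HasLogModulus (modulusConst m M L) fun x => Q x / p x := fun x y => by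
  have hL := h.modulus_nonneg x
  refine (h.integrability.hasLogModulus_div h.dimension h.metricMeasure hm).mono ?_ x y
  exact le_add_of_nonneg_left (by positivity)

variable [OpensMeasurableSpace X] {E : Set X} {u : X → ℝ} {g : X → ℝ≥0∞}

/-- Since the modular of `G` is at most one, some point of the ball satisfies
`G ^ p ≤ 1 / μ(B(x,r)) ≤ 1 / (b r ^ Q(x))`. -/
lemma exists_isGoodPoint (h : Admissible b δ m M L μ Q p s) (hb : 0 < b) (hb1 : b ≤ 1)
    (hm : 0 < m) {S : Set X} (hS : ∀ᵐ x ∂μ.restrict E, x ∈ S) {G : X → ℝ} (hG : ∀ x, 0 ≤ G x)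
    (hG_meas : AEMeasurable G (μ.restrict E))
    (hint : ∫⁻ x in E, ENNReal.ofReal (G x ^ p x) ∂μ ≤ 1) {x : X} {r : ℝ} (hr : 0 < r)
    (hrδ : r ≤ δ) (hball : Metric.ball x r ⊆ E) :
    ∃ y, IsGoodPoint (goodConst b δ m M L) S (fun x => Q x / p x) G x r y := by
  obtain ⟨hμ0, hμ_top⟩ := h.metricMeasure x r hr
  obtain ⟨y, hyS, hyx, hle⟩ := exists_mem_le_inv_of_setLIntegral_le_one measurableSet_ball
    hμ0.ne' hμ_top.ne (ae_restrict_of_ae_restrict_of_subset hball hS)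
    ((hG_meas.mono_measure (Measure.restrict_mono_set _ hball)).pow
      h.integrability.measurable.aemeasurable).ennreal_ofReal
    ((lintegral_mono_set hball).trans hint)
  have hbr : 0 < b * r ^ Q x := by positivity
  have hGp : G y ^ p y ≤ (b * r ^ Q x)⁻¹ := by
    rw [← ENNReal.ofReal_le_ofReal_iff (by positivity), ENNReal.ofReal_inv_of_pos hbr]
    exact hle.trans (ENNReal.inv_le_inv.2 (h.lowerAhlfors x r hr hrδ))
  refine ⟨y, hyS, hyx, le_trans ?_ (h.inv_rpow_inv_le hb hb1 hm hr hrδ hyx)⟩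
  exact (Real.le_rpow_inv_iff_of_pos (hG y) (by positivity) (h.integrability.pos y)).2 hGp

lemma gradientData (h : Admissible b δ m M L μ Q p s) (hb : 0 < b) (hb1 : b ≤ 1) (hm : 0 < m)
    (hg : AEMeasurable g (μ.restrict E)) {S : Set X} (hS : ∀ᵐ x ∂μ.restrict E, x ∈ S)
    (hg_top : ∀ x ∈ S, g x ≠ ∞) (hgrad : ∀ x ∈ S, ∀ y ∈ S, ENNReal.ofReal |u x - u y| ≤
      ENNReal.ofReal (dist x y ^ s x) * g x + ENNReal.ofReal (dist x y ^ s y) * g y)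
    {l : ℝ} (hl : luxNorm (μ.restrict E) p g < ENNReal.ofReal l) :
    GradientData δ (modulusConst m M L) (exponentBound m M) (goodConst b δ m M L) E S s
      (fun x => Q x / p x) (fun x => u x / l) (fun x => (g x).toReal / l) := by
  have hl0 : 0 < l := ENNReal.ofReal_pos.1 (bot_le.trans_lt hl)
  have hμ := h.metricMeasure
  have hp0 := h.integrability.pos
  constructor
  case s_nonneg => exact fun x => (h.smoothness.pos x).le
  case s_le =>
    exact fun x => (h.smoothness.apply_le hμ x).trans
      (le_add_of_nonneg_right (div_nonneg (h.bound_pos x).le hm.le))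
  case q_pos => exact fun x => div_pos (h.dimension.pos x) (hp0 x)
  case q_le =>
    exact fun x => (div_le_div₀ (h.bound_pos x).le (h.dimension.apply_le hμ x) hm
      (h.integrability.le_apply hμ x)).trans (le_add_of_nonneg_left (h.bound_pos x).le)
  case s_log => exact h.hasLogModulus_smoothness hm
  case q_log => exact h.hasLogModulus_div hm
  case G_nonneg => exact fun x => by positivity
  case gradient =>
    intro x hx y hy
    have hxy := hgrad x hx y hy
    rw [← ENNReal.ofReal_toReal (hg_top x hx), ← ENNReal.ofReal_toReal (hg_top y hy),
      ← ENNReal.ofReal_mul (by positivity), ← ENNReal.ofReal_mul (by positivity),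
      ← ENNReal.ofReal_add (by positivity) (by positivity),
      ENNReal.ofReal_le_ofReal_iff (by positivity)] at hxy
    rw [← sub_div, abs_div, abs_of_pos hl0, ← mul_div_assoc, ← mul_div_assoc, ← add_div]
    gcongr
  case exists_isGoodPoint =>
    exact fun x r hr hrδ hball => h.exists_isGoodPoint hb hb1 hm hS (fun x => by positivity)
      (hg.ennreal_toReal.div_const l)
      (lintegral_rpow_toReal_div_le_one_of_luxNorm_lt (fun x => (hp0 x).le) hl) hr hrδ hball

lemma exists_gradientData (h : Admissible b δ m M L μ Q p s) (hb : 0 < b) (hb1 : b ≤ 1)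
    (hm : 0 < m) (hE : MeasurableSet E) (hgrad : IsScalarGradient μ E s u g)
    (hg : MemLpVar (μ.restrict E) p g) :
    ∃ S : Set X, (∀ᵐ x ∂μ.restrict E, x ∈ S) ∧
      ∀ l : ℝ, luxNorm (μ.restrict E) p g < ENNReal.ofReal l →
        GradientData δ (modulusConst m M L) (exponentBound m M) (goodConst b δ m M L) E S s
          (fun x => Q x / p x) (fun x => u x / l) (fun x => (g x).toReal / l) := by
  obtain ⟨N, hN, hgradN⟩ := hgrad
  have hS : ∀ᵐ x ∂μ.restrict E, x ∈ {x | x ∈ E \ N ∧ g x ≠ ∞} := by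
    filter_upwards [hg.ae_ne_top h.integrability.measurable h.integrability.pos,
      ae_restrict_of_ae (measure_eq_zero_iff_ae_notMem.1 hN), ae_restrict_mem hE]
      with x hx_top hxN hxE using ⟨⟨hxE, hxN⟩, hx_top⟩
  exact ⟨_, hS, fun l hl => h.gradientData hb hb1 hm hg.1 hS (fun x hx => hx.2)
    (fun x hx y hy => hgradN x hx.1 y hy.1) hl⟩

end Admissible

end Extraction

section FiniteMeasure

variable [MeasurableSpace X] {ν : Measure X}

lemma lintegral_le_of_ae_le_add_mul [IsFiniteMeasure ν] {F : X → ℝ≥0∞} {H : X → ℝ} {ξ η : ℝ}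
    (hξ : 0 ≤ ξ) (hη : 0 ≤ η) (hH : ∀ x, 0 ≤ H x)
    (hF : ∀ᵐ x ∂ν, F x ≤ ENNReal.ofReal (ξ + η * H x))
    (hint : ∫⁻ x, ENNReal.ofReal (H x) ∂ν ≤ 1) :
    ∫⁻ x, F x ∂ν ≤ ENNReal.ofReal (ξ * ν.real univ + η) :=
  calc ∫⁻ x, F x ∂ν
      ≤ ∫⁻ x, (ENNReal.ofReal ξ + ENNReal.ofReal η * ENNReal.ofReal (H x)) ∂ν := by
        refine lintegral_mono_ae (hF.mono fun x hx => hx.trans_eq ?_)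
        rw [ENNReal.ofReal_add hξ (mul_nonneg hη (hH x)), ENNReal.ofReal_mul hη]
    _ = ENNReal.ofReal ξ * ν univ + ENNReal.ofReal η * ∫⁻ x, ENNReal.ofReal (H x) ∂ν := by
        rw [lintegral_add_left measurable_const, lintegral_const_mul' _ _ ENNReal.ofReal_ne_top,
          lintegral_const]
    _ ≤ ENNReal.ofReal ξ * ν univ + ENNReal.ofReal η * 1 := by gcongr
    _ = ENNReal.ofReal (ξ * ν.real univ + η) := by
        rw [mul_one, ENNReal.ofReal_add (by positivity) hη, ENNReal.ofReal_mul hξ,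
          ofReal_measureReal]

lemma integrable_and_eLpNorm_sub_average_le [IsFiniteMeasure ν] [NeZero ν] {F : Type*}
    [NormedAddCommGroup F] [NormedSpace ℝ F] [CompleteSpace F] {v : X → F}
    (hv : AEStronglyMeasurable v ν) {S : Set X} (hS : ∀ᵐ x ∂ν, x ∈ S) {C : ℝ}
    (hC : ∀ x ∈ S, ∀ y ∈ S, ‖v x - v y‖ ≤ C) :
    Integrable v ν ∧ eLpNorm (fun x => v x - ⨍ y, v y ∂ν) ∞ ν ≤ ENNReal.ofReal C := by
  obtain ⟨z, hz⟩ := hS.exists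
  have hint : Integrable v ν := by
    refine (integrable_const (‖v z‖ + C)).mono' hv ?_
    filter_upwards [hS] with x hx
    linarith [hC x hx z hz, norm_le_norm_add_norm_sub' (v x) (v z)]
  refine ⟨hint, ?_⟩
  rw [eLpNorm_exponent_top]
  refine eLpNormEssSup_le_of_ae_bound ?_
  filter_upwards [hS] with x hx
  have hmem : ∀ᵐ y ∂ν, v y ∈ Metric.closedBall (v x) C := by
    filter_upwards [hS] with y hy
    exact mem_closedBall_iff_norm.2 (hC y hy x hx)
  exact mem_closedBall_iff_norm'.1
    ((convex_closedBall (v x) C).average_mem Metric.isClosed_closedBall hmem hint)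

variable {v : X → ℝ} {c k : ℝ}

lemma integrable_of_integrable_exp_mul_abs_sub [IsFiniteMeasure ν] (hk : 0 < k)
    (hv : AEStronglyMeasurable v ν) (hexp : Integrable (fun x => Real.exp (k * |v x - c|)) ν) :
    Integrable v ν := by
  have hsub : Integrable (fun x => v x - c) ν := by
    refine (hexp.const_mul k⁻¹).mono' (hv.sub aestronglyMeasurable_const) (ae_of_all _ fun x => ?_)
    rw [Real.norm_eq_abs, inv_mul_eq_div, le_div_iff₀' hk]
    linarith [Real.add_one_le_exp (k * |v x - c|)]
  exact (hsub.add (integrable_const c)).congr (ae_of_all _ fun x => sub_add_cancel _ _)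

variable [IsFiniteMeasure ν] [NeZero ν]

lemma exp_mul_abs_average_sub_le (hk : 0 ≤ k) (hv : Integrable v ν)
    (hexp : Integrable (fun x => Real.exp (k * |v x - c|)) ν) :
    Real.exp (k * |(⨍ x, v x ∂ν) - c|) ≤ ⨍ x, Real.exp (k * |v x - c|) ∂ν := by
  have habs : ConvexOn ℝ univ fun y : ℝ => k * |y - c| := (convexOn_univ_dist c).smul hk
  have hconv : ConvexOn ℝ univ fun y : ℝ => Real.exp (k * |y - c|) :=
    ⟨convex_univ, fun x _ y _ _ _ ha hb hab =>
      (Real.exp_le_exp.2 (habs.2 (mem_univ x) (mem_univ y) ha hb hab)).trans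
        (convexOn_exp.2 (mem_univ _) (mem_univ _) ha hb hab)⟩
  exact hconv.map_average_le (by fun_prop) isClosed_univ (ae_of_all _ fun _ => mem_univ _) hv hexp

/-- Jensen's inequality bounds the cost of replacing the constant `c` by the mean value. -/
lemma laverage_exp_mul_abs_sub_average_le (hk : 0 ≤ k) (hv : Integrable v ν)
    (hexp : Integrable (fun x => Real.exp (k * |v x - c|)) ν) :
    ⨍⁻ x, ENNReal.ofReal (Real.exp (k * |v x - ⨍ y, v y ∂ν|)) ∂ν ≤
      ENNReal.ofReal ((⨍ x, Real.exp (k * |v x - c|) ∂ν) ^ 2) := by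
  set a := ⨍ y, v y ∂ν
  set I := ⨍ x, Real.exp (k * |v x - c|) ∂ν
  have hI : Real.exp (k * |a - c|) ≤ I := exp_mul_abs_average_sub_le hk hv hexp
  have hI0 : 0 ≤ I := (Real.exp_pos _).le.trans hI
  have hpt (x : X) : Real.exp (k * |v x - a|) ≤ I * Real.exp (k * |v x - c|) :=
    calc Real.exp (k * |v x - a|) ≤ Real.exp (k * |a - c| + k * |v x - c|) := by
          rw [← mul_add, add_comm, abs_sub_comm a c]
          gcongr
          exact abs_sub_le _ _ _
      _ ≤ I * Real.exp (k * |v x - c|) := by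
          rw [Real.exp_add]
          gcongr
  rw [laverage_eq]
  calc (∫⁻ x, ENNReal.ofReal (Real.exp (k * |v x - a|)) ∂ν) / ν univ
      ≤ (∫⁻ x, ENNReal.ofReal I * ENNReal.ofReal (Real.exp (k * |v x - c|)) ∂ν) / ν univ := by
        gcongr with x
        rw [← ENNReal.ofReal_mul hI0]
        exact ENNReal.ofReal_le_ofReal (hpt x)
    _ = ENNReal.ofReal I * ((∫⁻ x, ENNReal.ofReal (Real.exp (k * |v x - c|)) ∂ν) / ν univ) := by
        rw [lintegral_const_mul' _ _ ENNReal.ofReal_ne_top, mul_div_assoc]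
    _ = ENNReal.ofReal (I ^ 2) := by
        rw [← ofReal_average hexp (ae_of_all _ fun _ => (Real.exp_pos _).le),
          ← ENNReal.ofReal_mul hI0, sq]

lemma integrable_and_laverage_exp_le_of_lintegral_exp_le (hk : 0 < k)
    (hv : AEStronglyMeasurable v ν) {T : ℝ} (hT : 0 ≤ T)
    (h : ∫⁻ x, ENNReal.ofReal (Real.exp (k * |v x - c|)) ∂ν ≤ ENNReal.ofReal (T * ν.real univ)) :
    Integrable v ν ∧
      ⨍⁻ x, ENNReal.ofReal (Real.exp (k * |v x - ⨍ y, v y ∂ν|)) ∂ν ≤ ENNReal.ofReal (T ^ 2) := by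
  have hexp0 : 0 ≤ᵐ[ν] fun x => Real.exp (k * |v x - c|) := ae_of_all _ fun _ => (Real.exp_pos _).le
  have hmeas : AEStronglyMeasurable (fun x => Real.exp (k * |v x - c|)) ν :=
    (by fun_prop : Continuous fun y => Real.exp (k * |y - c|)).comp_aestronglyMeasurable hv
  have hexp : Integrable (fun x => Real.exp (k * |v x - c|)) ν :=
    ⟨hmeas, (hasFiniteIntegral_iff_ofReal hexp0).2 (h.trans_lt ENNReal.ofReal_lt_top)⟩
  have hint : Integrable v ν := integrable_of_integrable_exp_mul_abs_sub hk hv hexp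
  refine ⟨hint, (laverage_exp_mul_abs_sub_average_le hk.le hint hexp).trans ?_⟩
  have hν : 0 < ν.real univ := measureReal_univ_pos
  have havg : ⨍ x, Real.exp (k * |v x - c|) ∂ν ≤ T := by
    rw [average_eq, smul_eq_mul, inv_mul_le_iff₀ hν, mul_comm,
      integral_eq_lintegral_of_nonneg_ae hexp0 hmeas]
    exact ENNReal.toReal_le_of_le_ofReal (by positivity) h
  gcongr
  exact integral_nonneg fun _ => (Real.exp_pos _).le

end FiniteMeasure

section Extension

variable [TopologicalSpace X] {Y : Type*} [MetricSpace Y] [CompleteSpace Y] {T : Set X} {u : X → Y}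
  {ω : X × X → ℝ} {x y : X}

lemma exists_tendsto_of_dist_le (hω : Continuous ω) (hω0 : ∀ x, ω (x, x) = 0)
    (hu : ∀ x ∈ T, ∀ y ∈ T, dist (u x) (u y) ≤ ω (x, y)) (hx : x ∈ closure T) :
    ∃ l, Tendsto u (𝓝[T] x) (𝓝 l) := by
  have : (𝓝[T] x).NeBot := mem_closure_iff_nhdsWithin_neBot.1 hx
  have hlim : Tendsto ω (𝓝[T] x ×ˢ 𝓝[T] x) (𝓝 0) := by
    rw [← hω0 x]
    refine (hω.tendsto (x, x)).mono_left ?_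
    rw [nhds_prod_eq]
    exact prod_mono nhdsWithin_le_nhds nhdsWithin_le_nhds
  refine cauchy_map_iff_exists_tendsto.1 (cauchy_map_iff.2 ⟨this, ?_⟩)
  rw [tendsto_uniformity_iff_dist_tendsto_zero]
  refine squeeze_zero' (Eventually.of_forall fun _ => dist_nonneg) ?_ hlim
  filter_upwards [prod_mem_prod self_mem_nhdsWithin self_mem_nhdsWithin] with w hw
  exact hu _ hw.1 _ hw.2

lemma dist_extendFrom_le (hω : Continuous ω) (hω0 : ∀ x, ω (x, x) = 0)
    (hu : ∀ x ∈ T, ∀ y ∈ T, dist (u x) (u y) ≤ ω (x, y)) (hx : x ∈ closure T)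
    (hy : y ∈ closure T) : dist (extendFrom T u x) (extendFrom T u y) ≤ ω (x, y) := by
  have : (𝓝[T] x).NeBot := mem_closure_iff_nhdsWithin_neBot.1 hx
  have : (𝓝[T] y).NeBot := mem_closure_iff_nhdsWithin_neBot.1 hy
  have hux := tendsto_extendFrom (exists_tendsto_of_dist_le hω hω0 hu hx)
  have huy := tendsto_extendFrom (exists_tendsto_of_dist_le hω hω0 hu hy)
  have hlim : Tendsto ω (𝓝[T] x ×ˢ 𝓝[T] y) (𝓝 (ω (x, y))) := by
    refine (hω.tendsto (x, y)).mono_left ?_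
    rw [nhds_prod_eq]
    exact prod_mono nhdsWithin_le_nhds nhdsWithin_le_nhds
  refine le_of_tendsto_of_tendsto ((hux.comp tendsto_fst).dist (huy.comp tendsto_snd)) hlim ?_
  filter_upwards [prod_mem_prod self_mem_nhdsWithin self_mem_nhdsWithin] with w hw
  exact hu _ hw.1 _ hw.2

lemma extendFrom_eq_of_dist_le (hω : Continuous ω) (hω0 : ∀ x, ω (x, x) = 0)
    (hu : ∀ x ∈ T, ∀ y ∈ T, dist (u x) (u y) ≤ ω (x, y)) (hx : x ∈ T) :
    extendFrom T u x = u x := by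
  have hlim := tendsto_extendFrom (exists_tendsto_of_dist_le hω hω0 hu (subset_closure hx))
  exact tendsto_nhds_unique (hlim.mono_left (pure_le_nhdsWithin hx)) (tendsto_pure_nhds u x)

end Extension

lemma le_apply_toReal_of_forall_lt_ofReal {Y : Type*} [TopologicalSpace Y] [Preorder Y]
    [OrderClosedTopology Y] {F : ℝ → Y} (hF : Continuous F) {n : ℝ≥0∞} (hn : n ≠ ∞) {c : Y}
    (h : ∀ l : ℝ, n < ENNReal.ofReal l → c ≤ F l) : c ≤ F n.toReal := by
  have hlim : Tendsto F (𝓝[>] n.toReal) (𝓝 (F n.toReal)) :=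
    (hF.tendsto _).mono_left nhdsWithin_le_nhds
  refine ge_of_tendsto hlim ?_
  filter_upwards [self_mem_nhdsWithin] with l hl
  exact h l ((ENNReal.lt_ofReal_iff_toReal_lt hn).2 hl)

section ExponentBounds

variable {Q p s : X → ℝ} {x : X} {M θ : ℝ}

lemma holderExp_eq_div (hp : p x ≠ 0) : holderExp Q p s x = (s x * p x - Q x) / p x := by
  rw [holderExp]
  field_simp

lemma le_holderExp (hp : 0 < p x) (hpM : p x ≤ M) (hθ : 0 ≤ θ) (h : Q x + θ ≤ s x * p x) :
    θ / M ≤ holderExp Q p s x := by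
  rw [holderExp_eq_div hp.ne']
  exact div_le_div₀ (by linarith) (by linarith) hp hpM

lemma holderExp_le_neg (hp : 0 < p x) (hpM : p x ≤ M) (hθ : 0 ≤ θ) (h : s x * p x + θ ≤ Q x) :
    holderExp Q p s x ≤ -(θ / M) := by
  rw [holderExp_eq_div hp.ne', ← neg_sub, neg_div]
  exact neg_le_neg (div_le_div₀ (by linarith) (by linarith) hp hpM)

lemma le_sobolevConj (hs : 0 ≤ s x) (hp : 0 < p x) (h : s x * p x < Q x) :
    p x ≤ sobolevConj Q p s x := by
  rw [sobolevConj, le_div_iff₀ (sub_pos.2 h), mul_comm]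
  gcongr
  linarith [mul_nonneg hs hp.le]

lemma sobolevConj_le (hp : 0 < p x) (hpM : p x ≤ M) (hQM : Q x ≤ M) (hθ : 0 < θ)
    (h : s x * p x + θ ≤ Q x) : sobolevConj Q p s x ≤ M ^ 2 / θ := by
  rw [sobolevConj, sq]
  have : 0 < M := hp.trans_le hpM
  gcongr
  linarith

lemma holderExp_mul_sobolevConj (hp : p x ≠ 0) (h : s x * p x ≠ Q x) :
    holderExp Q p s x * sobolevConj Q p s x = -Q x := by
  have hd : Q x - s x * p x ≠ 0 := sub_ne_zero.2 h.symm
  rw [holderExp_eq_div hp, sobolevConj]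
  field_simp
  ring

end ExponentBounds

lemma ball_sub_one_mul_subset [PseudoMetricSpace X] {x x₀ : X} {σ r : ℝ}
    (hx : x ∈ Metric.ball x₀ r) : Metric.ball x ((σ - 1) * r) ⊆ Metric.ball x₀ (σ * r) :=
  Metric.ball_subset_ball' (by linarith [Metric.mem_ball.1 hx])

namespace Admissible

variable [MetricSpace X] [MeasurableSpace X] {μ : Measure X} {b σ δ m M L θ r₀ : ℝ}
  {Q p s : X → ℝ} {x x₀ : X}

lemma le_measureReal_div (h : Admissible b δ m M L μ Q p s) {r : ℝ} (hr : 0 < r) (hrδ : r ≤ δ) :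
    b ≤ μ.real (Metric.ball x r) / r ^ Q x := by
  rw [le_div_iff₀ (by positivity)]
  exact (ENNReal.ofReal_le_iff_le_toReal (h.metricMeasure x r hr).2.ne).1
    (h.lowerAhlfors x r hr hrδ)

lemma scale_rpow_neg_le (h : Admissible b δ m M L μ Q p s) (hσ : 1 < σ) (hr₀ : 0 < r₀)
    (hρδ : (σ - 1) * r₀ ≤ δ) (hx : x ∈ Metric.ball x₀ r₀) {G : ℝ} (hG : 0 ≤ G) :
    scale (Q x / p x) ((σ - 1) * r₀) G ^ (-Q x) ≤
      G ^ p x + scaleFactor δ (M ^ 2 * L) M (σ - 1) * r₀ ^ (-Q x₀) := by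
  have hσ' : 0 < σ - 1 := sub_pos.2 hσ
  have hp := h.integrability.pos x
  have hQ := h.dimension.pos
  have hscale := scale_rpow_neg_mul_le (p := p x) (div_pos (hQ x) hp) (mul_pos hσ' hr₀) hG
  rw [div_mul_cancel₀ _ hp.ne'] at hscale
  have hQM : |-Q x₀| ≤ M := by
    rw [abs_neg, abs_of_pos (hQ x₀)]
    exact h.dimension.apply_le h.metricMeasure x₀
  have hρ := (h.dimension.hasLogModulus h.metricMeasure).neg.mul_rpow_le hσ' hr₀ hρδ hQM
    (Metric.mem_ball.1 hx).le
  linarith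

lemma le_sobolevConj (h : Admissible b δ m M L μ Q p s) (hsp : s x * p x < Q x) :
    m ≤ sobolevConj Q p s x :=
  (h.integrability.le_apply h.metricMeasure x).trans
    (VarExp.le_sobolevConj (h.smoothness.pos x).le (h.integrability.pos x) hsp)

lemma sobolevConj_le (h : Admissible b δ m M L μ Q p s) (hθ : 0 < θ)
    (hsp : s x * p x + θ ≤ Q x) : sobolevConj Q p s x ≤ M ^ 2 / θ :=
  VarExp.sobolevConj_le (h.integrability.pos x) (h.integrability.apply_le h.metricMeasure x)
    (h.dimension.apply_le h.metricMeasure x) hθ hsp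

end Admissible

section SobolevPoincare

lemma rpow_mul_le_rpow {a b e κ : ℝ} (hb : 0 < b) (hb1 : b ≤ 1) (hba : b ≤ a) (hκ : 1 ≤ κ)
    (hκe : κ ≤ e) : b ^ e * a ≤ a ^ κ := by
  have ha : 0 < a := hb.trans_le hba
  rcases le_total 1 a with ha1 | ha1
  · calc b ^ e * a ≤ 1 * a ^ (1 : ℝ) := by
          rw [Real.rpow_one]
          gcongr
          exact Real.rpow_le_one hb.le hb1 (by linarith)
      _ ≤ a ^ κ := by
          rw [one_mul]
          exact Real.rpow_le_rpow_of_exponent_le ha1 hκ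
  · calc b ^ e * a ≤ a ^ e * 1 := by
          gcongr
          linarith
      _ ≤ a ^ κ := by
          rw [mul_one]
          exact Real.rpow_le_rpow_of_exponent_ge ha ha1 hκe

lemma mul_le_mul_rpow_rpow {a b c e m γ γ₀ : ℝ} (hb : 0 < b) (hb1 : b ≤ 1) (hba : b ≤ a)
    (hc : 1 ≤ c) (hm : 0 < m) (hγ₀ : m ≤ γ₀) (hγ : γ₀ ≤ γ) (hγe : γ ≤ e * m) :
    c * a ≤ ((c / b ^ e) ^ m⁻¹ * a ^ (1 / γ₀)) ^ γ := by
  have ha : 0 < a := hb.trans_le hba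
  have hγ₀0 : 0 < γ₀ := hm.trans_le hγ₀
  have he : 0 < e := pos_of_mul_pos_left (by linarith) hm.le
  have hκ : 1 ≤ γ / γ₀ := (one_le_div hγ₀0).2 hγ
  have hκe : γ / γ₀ ≤ e := by
    rw [div_le_iff₀ hγ₀0]
    exact hγe.trans (by gcongr)
  have hcb : 1 ≤ c / b ^ e := by
    rw [one_le_div (by positivity)]
    exact (Real.rpow_le_one hb.le hb1 he.le).trans hc
  calc c * a = c / b ^ e * (b ^ e * a) := by field_simp
    _ ≤ (c / b ^ e) ^ (m⁻¹ * γ) * a ^ (γ / γ₀) := by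
        gcongr
        · refine Real.self_le_rpow_of_one_le hcb ?_
          rw [inv_mul_eq_div, one_le_div hm]
          exact hγ₀.trans hγ
        · exact rpow_mul_le_rpow hb hb1 hba hκ hκe
    _ = ((c / b ^ e) ^ m⁻¹ * a ^ (1 / γ₀)) ^ γ := by
        rw [Real.mul_rpow (by positivity) (by positivity), ← Real.rpow_mul (by positivity),
          ← Real.rpow_mul ha.le, one_div_mul_eq_div]

lemma enorm_div_div_ofReal {a K l : ℝ} (hl : 0 < l) :
    ‖a / l‖ₑ / ENNReal.ofReal K = ‖a‖ₑ / ENNReal.ofReal (K * l) := by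
  rw [div_eq_mul_inv a, enorm_mul, Real.enorm_of_nonneg (inv_nonneg.2 hl.le),
    ENNReal.ofReal_inv_of_pos hl, ← div_eq_mul_inv, ENNReal.ofReal_mul' hl.le]
  simp only [div_eq_mul_inv]
  rw [ENNReal.mul_inv (Or.inr ENNReal.ofReal_ne_top) (Or.inr (ENNReal.ofReal_pos.2 hl).ne')]
  ring

/-- The factor by which the measure of the ball enters the Sobolev–Poincaré constant. -/
def volumeFactor (b σ δ m M L θ : ℝ) : ℝ :=
  ((1 / b + scaleFactor δ (M ^ 2 * L) M (σ - 1)) / b ^ (M ^ 2 / θ / m)) ^ m⁻¹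

/-- The constant in the Sobolev–Poincaré inequality. -/
def sobolevConst (b σ δ m M L θ : ℝ) : ℝ :=
  subcriticalConst δ (modulusConst m M L) (exponentBound m M) (goodConst b δ m M L) (σ - 1)⁻¹
    (θ / M) * volumeFactor b σ δ m M L θ

lemma sobolevConst_pos {b σ : ℝ} (hb : 0 < b) (hσ : 1 < σ) (δ m M L θ : ℝ) :
    0 < sobolevConst b σ δ m M L θ := by
  have hsub := subcriticalConst_pos (δ := δ) (Λ := modulusConst m M L) (R := exponentBound m M)
    (a₀ := θ / M) (inv_nonneg.2 (sub_pos.2 hσ).le) (goodConst_pos hb δ m M L).le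
  have := scaleFactor_pos δ (M ^ 2 * L) M (σ - 1)
  unfold sobolevConst volumeFactor
  positivity

namespace Admissible

variable [MetricSpace X] [MeasurableSpace X] {μ : Measure X} {b σ δ m M L θ r₀ : ℝ}
  {Q p s : X → ℝ} {x x₀ z : X} {S : Set X} {u G : X → ℝ}

lemma essInf_sobolevConj_le (h : Admissible b δ m M L μ Q p s)
    (hsp : ∀ x, s x * p x < Q x) (B : Set X) :
    ∀ᵐ x ∂μ.restrict B, essInf (sobolevConj Q p s) (μ.restrict B) ≤ sobolevConj Q p s x :=
  ae_essInf_le ⟨m, eventually_map.2 (Eventually.of_forall fun x => h.le_sobolevConj (hsp x))⟩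

lemma le_essInf_sobolevConj (h : Admissible b δ m M L μ Q p s)
    (hθ : 0 < θ) (hsp : ∀ x, s x * p x + θ ≤ Q x) {B : Set X} (hB : μ B ≠ 0) :
    m ≤ essInf (sobolevConj Q p s) (μ.restrict B) := by
  have : (ae (μ.restrict B)).NeBot := ae_neBot.2 (by rwa [Ne, Measure.restrict_eq_zero])
  refine le_liminf_of_le (IsBoundedUnder.isCoboundedUnder_ge ⟨M ^ 2 / θ, ?_⟩) ?_
  · exact eventually_map.2 (Eventually.of_forall fun x => h.sobolevConj_le hθ (hsp x))
  · exact Eventually.of_forall fun x => h.le_sobolevConj (by linarith [hsp x])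

lemma div_rpow_sobolevConj_le (h : Admissible b δ m M L μ Q p s) (hσ : 1 < σ) (hb : 0 < b)
    (hθ : 0 < θ) (hsp : s x * p x + θ ≤ Q x) (hr₀ : 0 < r₀) (hrδ : σ * r₀ ≤ δ)
    (hdata : GradientData δ (modulusConst m M L) (exponentBound m M) (goodConst b δ m M L)
      (Metric.ball x₀ (σ * r₀)) S s (fun x => Q x / p x) u G)
    (hz : IsGoodPoint (goodConst b δ m M L) S (fun x => Q x / p x) G x₀ ((σ - 1) * r₀) z)
    (hxS : x ∈ S) (hx : x ∈ Metric.ball x₀ r₀) :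
    (|u x - u z| / subcriticalConst δ (modulusConst m M L) (exponentBound m M)
      (goodConst b δ m M L) (σ - 1)⁻¹ (θ / M)) ^ sobolevConj Q p s x ≤
      G x ^ p x + scaleFactor δ (M ^ 2 * L) M (σ - 1) * r₀ ^ (-Q x₀) := by
  have hσ' : 0 < σ - 1 := sub_pos.2 hσ
  have hρδ : (σ - 1) * r₀ ≤ δ := by linarith
  have hp := h.integrability.pos x
  have hpM := h.integrability.apply_le h.metricMeasure x
  have hM := h.bound_pos x
  have hγ : 0 ≤ sobolevConj Q p s x :=
    hp.le.trans (VarExp.le_sobolevConj (h.smoothness.pos x).le hp (by linarith))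
  have hdist : dist x x₀ ≤ (σ - 1)⁻¹ * ((σ - 1) * r₀) := by
    rw [inv_mul_cancel_left₀ hσ'.ne']
    exact (Metric.mem_ball.1 hx).le
  have hle := hdata.abs_sub_le_of_subcritical (div_pos hθ hM)
    (holderExp_le_neg hp hpM hθ.le hsp) hρδ hxS (ball_sub_one_mul_subset hx) hdist hz
  have hC := subcriticalConst_pos (δ := δ) (Λ := modulusConst m M L) (R := exponentBound m M)
    (a₀ := θ / M) (inv_nonneg.2 hσ'.le) (goodConst_pos hb δ m M L).le
  set t := scale (Q x / p x) ((σ - 1) * r₀) (G x)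
  have ht : 0 < t := scale_pos hz.radius_pos
  calc _ ≤ (t ^ holderExp Q p s x) ^ sobolevConj Q p s x := by
        gcongr
        rw [div_le_iff₀' hC]
        exact hle
    _ = t ^ (-Q x) := by
        rw [← Real.rpow_mul ht.le, holderExp_mul_sobolevConj hp.ne' (by linarith)]
    _ ≤ _ := h.scale_rpow_neg_le hσ hr₀ hρδ hx (hdata.G_nonneg x)

lemma enorm_div_rpow_sobolevConj_le (h : Admissible b δ m M L μ Q p s) (hσ : 1 < σ) (hb : 0 < b)
    (hb1 : b ≤ 1) (hm : 0 < m) (hθ : 0 < θ) (hsp : s x * p x + θ ≤ Q x) (hr₀ : 0 < r₀)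
    (hrδ : σ * r₀ ≤ δ)
    (hdata : GradientData δ (modulusConst m M L) (exponentBound m M) (goodConst b δ m M L)
      (Metric.ball x₀ (σ * r₀)) S s (fun x => Q x / p x) u G)
    (hz : IsGoodPoint (goodConst b δ m M L) S (fun x => Q x / p x) G x₀ ((σ - 1) * r₀) z)
    (hxS : x ∈ S) (hx : x ∈ Metric.ball x₀ r₀) {a γ₀ : ℝ} (hba : b ≤ a) (hγ₀ : m ≤ γ₀)
    (hγ : γ₀ ≤ sobolevConj Q p s x) :
    (‖u x - u z‖ₑ / ENNReal.ofReal (sobolevConst b σ δ m M L θ * a ^ (1 / γ₀))) ^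
      sobolevConj Q p s x ≤
      ENNReal.ofReal ((G x ^ p x + scaleFactor δ (M ^ 2 * L) M (σ - 1) * r₀ ^ (-Q x₀)) /
        ((1 / b + scaleFactor δ (M ^ 2 * L) M (σ - 1)) * a)) := by
  have hV := scaleFactor_pos δ (M ^ 2 * L) M (σ - 1)
  have ha : 0 < a := hb.trans_le hba
  have hC := sobolevConst_pos hb hσ δ m M L θ
  have hP := subcriticalConst_pos (δ := δ) (Λ := modulusConst m M L) (R := exponentBound m M)
    (a₀ := θ / M) (inv_nonneg.2 (sub_pos.2 hσ).le) (goodConst_pos hb δ m M L).le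
  have hF : 0 ≤ volumeFactor b σ δ m M L θ := by
    rw [volumeFactor]
    positivity
  have hb_inv : 1 ≤ 1 / b := (one_le_div hb).2 hb1
  have hγe : sobolevConj Q p s x ≤ M ^ 2 / θ / m * m := by
    rw [div_mul_cancel₀ _ hm.ne']
    exact h.sobolevConj_le hθ hsp
  rw [← ofReal_norm, ← ENNReal.ofReal_div_of_pos (by positivity),
    ENNReal.ofReal_rpow_of_nonneg (by positivity) (by linarith), Real.norm_eq_abs]
  refine ENNReal.ofReal_le_ofReal ?_
  rw [sobolevConst, mul_assoc, ← div_div, Real.div_rpow (by positivity) (by positivity)]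
  have := hdata.G_nonneg x
  gcongr
  · exact h.div_rpow_sobolevConj_le hσ hb hθ hsp hr₀ hrδ hdata hz hxS hx
  · exact mul_le_mul_rpow_rpow hb hb1 hba (by linarith) hm hγ₀ hγ hγe

variable [OpensMeasurableSpace X]

/-- The normalising factor `V + 1 / b` absorbs both the contribution of the scales comparable to
`r₀` and that of the gradient, because `μ(B) ≥ b r₀ ^ Q(x₀)`. -/
lemma modular_sobolevConj_le_one (h : Admissible b δ m M L μ Q p s) (hσ : 1 < σ) (hb : 0 < b)
    (hb1 : b ≤ 1) (hm : 0 < m) (hθ : 0 < θ) (hsp : ∀ x, s x * p x + θ ≤ Q x) (hr₀ : 0 < r₀)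
    (hrδ : σ * r₀ ≤ δ) (hS : ∀ᵐ x ∂μ.restrict (Metric.ball x₀ r₀), x ∈ S)
    (hdata : GradientData δ (modulusConst m M L) (exponentBound m M) (goodConst b δ m M L)
      (Metric.ball x₀ (σ * r₀)) S s (fun x => Q x / p x) u G)
    (hz : IsGoodPoint (goodConst b δ m M L) S (fun x => Q x / p x) G x₀ ((σ - 1) * r₀) z)
    (hint : ∫⁻ x in Metric.ball x₀ r₀, ENNReal.ofReal (G x ^ p x) ∂μ ≤ 1) :
    modular (μ.restrict (Metric.ball x₀ r₀)) (sobolevConj Q p s) (fun x => ‖u x - u z‖ₑ /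
      ENNReal.ofReal (sobolevConst b σ δ m M L θ *
        (μ.real (Metric.ball x₀ r₀) / r₀ ^ Q x₀) ^
          (1 / essInf (sobolevConj Q p s) (μ.restrict (Metric.ball x₀ r₀))))) ≤ 1 := by
  set B := Metric.ball x₀ r₀
  set a := μ.real B / r₀ ^ Q x₀ with ha_def
  set V := scaleFactor δ (M ^ 2 * L) M (σ - 1) with hV_def
  have hV : 0 < V := scaleFactor_pos _ _ _ _
  have hba : b ≤ a := h.le_measureReal_div hr₀ (by nlinarith)
  have ha : 0 < a := hb.trans_le hba
  obtain ⟨hB0, hB_top⟩ := h.metricMeasure x₀ r₀ hr₀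
  have : IsFiniteMeasure (μ.restrict B) := ⟨by simpa using hB_top⟩
  refine (lintegral_le_of_ae_le_add_mul (H := fun x => G x ^ p x)
    (ξ := V * r₀ ^ (-Q x₀) / ((1 / b + V) * a)) (η := 1 / ((1 / b + V) * a)) (by positivity)
    (by positivity) (fun x => Real.rpow_nonneg (hdata.G_nonneg x) _) ?_ hint).trans ?_
  · filter_upwards [hS, ae_restrict_mem measurableSet_ball,
      h.essInf_sobolevConj_le (fun x => by linarith [hsp x]) B] with x hxS hxB hγ
    refine (h.enorm_div_rpow_sobolevConj_le hσ hb hb1 hm hθ (hsp x) hr₀ hrδ hdata hz hxS hxB hba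
      (h.le_essInf_sobolevConj hθ hsp hB0.ne') hγ).trans_eq ?_
    rw [← hV_def]
    ring_nf
  · rw [measureReal_restrict_apply_univ, ENNReal.ofReal_le_one]
    calc _ = (V * a + 1) / ((1 / b + V) * a) := by
          rw [ha_def, Real.rpow_neg hr₀.le]
          ring
      _ ≤ 1 := by
          rw [div_le_one (by positivity), add_mul, one_div_mul_eq_div, add_comm]
          gcongr
          exact (one_le_div hb).2 hba

theorem sobolev_poincare (h : Admissible b δ m M L μ Q p s) (hσ : 1 < σ) (hb : 0 < b)
    (hb1 : b ≤ 1) (hm : 0 < m) (hθ : 0 < θ) (hsp : ∀ x, s x * p x + θ ≤ Q x) (hr₀ : 0 < r₀)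
    (hrδ : σ * r₀ ≤ δ) {g : X → ℝ≥0∞}
    (hgrad : IsScalarGradient μ (Metric.ball x₀ (σ * r₀)) s u g)
    (hg : MemLpVar (μ.restrict (Metric.ball x₀ (σ * r₀))) p g) :
    ⨅ c : ℝ, luxNorm (μ.restrict (Metric.ball x₀ r₀)) (sobolevConj Q p s) (fun x => ‖u x - c‖ₑ) ≤
      ENNReal.ofReal (sobolevConst b σ δ m M L θ *
        (μ.real (Metric.ball x₀ r₀) / r₀ ^ Q x₀) ^
          (1 / essInf (sobolevConj Q p s) (μ.restrict (Metric.ball x₀ r₀)))) *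
        luxNorm (μ.restrict (Metric.ball x₀ (σ * r₀))) p g := by
  set n := luxNorm (μ.restrict (Metric.ball x₀ (σ * r₀))) p g
  have hn : n ≠ ∞ :=
    (luxNorm_lt_top hm (h.integrability.le_apply h.metricMeasure) hg.2).ne
  set K := sobolevConst b σ δ m M L θ * (μ.real (Metric.ball x₀ r₀) / r₀ ^ Q x₀) ^
    (1 / essInf (sobolevConj Q p s) (μ.restrict (Metric.ball x₀ r₀))) with hK_def
  have hK : 0 < K := by
    have := hb.trans_le (h.le_measureReal_div (x := x₀) hr₀ (by nlinarith))
    have := sobolevConst_pos hb hσ δ m M L θ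
    positivity
  have hball : Metric.ball x₀ r₀ ⊆ Metric.ball x₀ (σ * r₀) :=
    Metric.ball_subset_ball (by nlinarith)
  obtain ⟨S, hS, hdata⟩ := h.exists_gradientData hb hb1 hm measurableSet_ball hgrad hg
  rw [← ENNReal.ofReal_toReal hn, ← ENNReal.ofReal_mul hK.le]
  refine le_apply_toReal_of_forall_lt_ofReal (F := fun l => ENNReal.ofReal (K * l))
    (ENNReal.continuous_ofReal.comp (continuous_const_mul K)) hn fun l hl => ?_
  have hl0 : 0 < l := ENNReal.ofReal_pos.1 (bot_le.trans_lt hl)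
  obtain ⟨z, hz⟩ := (hdata l hl).exists_isGoodPoint x₀ ((σ - 1) * r₀)
    (mul_pos (sub_pos.2 hσ) hr₀) (by linarith)
    (ball_sub_one_mul_subset (Metric.mem_ball_self hr₀))
  have hint := lintegral_rpow_toReal_div_le_one_of_luxNorm_lt
    (fun x => (h.integrability.pos x).le) hl
  have hmod := h.modular_sobolevConj_le_one hσ hb hb1 hm hθ hsp hr₀ hrδ
    (ae_restrict_of_ae_restrict_of_subset hball hS) (hdata l hl) hz
    ((lintegral_mono_set hball).trans hint)
  refine iInf_le_of_le (u z) (luxNorm_le_of_modular_le_one (by simpa using mul_pos hK hl0)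
    ENNReal.ofReal_ne_top ?_)
  simpa only [← sub_div, ← hK_def, enorm_div_div_ofReal hl0] using hmod

end Admissible

end SobolevPoincare

section MoserTrudinger

/-- The coefficient in the exponent in the Moser–Trudinger inequality, for functions whose gradient
has norm less than one. -/
def moserTrudingerRate (b σ δ m M L : ℝ) : ℝ :=
  m * Real.log 2 / criticalConst δ (modulusConst m M L) (exponentBound m M) (goodConst b δ m M L)
    (σ - 1)⁻¹

/-- The bound for the mean of `exp (k * |u - c|)`, where `k` is `moserTrudingerRate` and `c` is the
value of `u` at a good point. -/
def moserTrudingerBound (b σ δ m M L : ℝ) : ℝ :=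
  4 ^ m * (1 + scaleFactor δ (M ^ 2 * L) M (σ - 1) / b)

lemma moserTrudingerRate_pos {b σ m : ℝ} (hb : 0 < b) (hσ : 1 < σ) (hm : 0 < m) (δ M L : ℝ) :
    0 < moserTrudingerRate b σ δ m M L :=
  div_pos (mul_pos hm (Real.log_pos one_lt_two))
    (criticalConst_pos (inv_nonneg.2 (sub_pos.2 hσ).le) (goodConst_pos hb δ m M L).le)

lemma moserTrudingerBound_pos {b : ℝ} (hb : 0 < b) (σ δ m M L : ℝ) :
    0 < moserTrudingerBound b σ δ m M L := by
  have := scaleFactor_pos δ (M ^ 2 * L) M (σ - 1)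
  unfold moserTrudingerBound
  positivity

namespace Admissible

variable [MetricSpace X] [MeasurableSpace X] {μ : Measure X} {b σ δ m M L r₀ : ℝ}
  {Q p s : X → ℝ} {x x₀ z : X} {S : Set X} {u G : X → ℝ}

lemma div_scale_rpow_dimension_le (h : Admissible b δ m M L μ Q p s) (hσ : 1 < σ) (hr₀ : 0 < r₀)
    (hρδ : (σ - 1) * r₀ ≤ δ) (hx : x ∈ Metric.ball x₀ r₀) {G : ℝ} (hG : 0 ≤ G) :
    ((σ - 1) * r₀ / scale (Q x / p x) ((σ - 1) * r₀) G) ^ Q x ≤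
      1 + scaleFactor δ (M ^ 2 * L) M (σ - 1) * r₀ ^ Q x₀ * G ^ p x := by
  have hσ' : 0 < σ - 1 := sub_pos.2 hσ
  have hρ : 0 < (σ - 1) * r₀ := mul_pos hσ' hr₀
  have hp := h.integrability.pos x
  have hQ := h.dimension.pos
  have hscale := scale_rpow_neg_mul_le (p := p x) (div_pos (hQ x) hp) hρ hG
  rw [div_mul_cancel₀ _ hp.ne'] at hscale
  have hQM : |Q x₀| ≤ M := by
    rw [abs_of_pos (hQ x₀)]
    exact h.dimension.apply_le h.metricMeasure x₀
  calc _ = ((σ - 1) * r₀) ^ Q x * scale (Q x / p x) ((σ - 1) * r₀) G ^ (-Q x) := by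
        rw [Real.div_rpow hρ.le (scale_pos hρ).le, Real.rpow_neg (scale_pos hρ).le, div_eq_mul_inv]
    _ ≤ ((σ - 1) * r₀) ^ Q x * (G ^ p x + ((σ - 1) * r₀) ^ (-Q x)) := by gcongr
    _ = 1 + ((σ - 1) * r₀) ^ Q x * G ^ p x := by
        rw [mul_add, ← Real.rpow_add hρ, add_neg_cancel, Real.rpow_zero, add_comm]
    _ ≤ _ := by
        gcongr
        exact (h.dimension.hasLogModulus h.metricMeasure).mul_rpow_le hσ' hr₀ hρδ hQM
          (Metric.mem_ball.1 hx).le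

lemma exp_mul_abs_sub_le (h : Admissible b δ m M L μ Q p s) (hσ : 1 < σ) (hb : 0 < b) (hm : 0 < m)
    (hsp : s x * p x = Q x) (hr₀ : 0 < r₀) (hrδ : σ * r₀ ≤ δ)
    (hdata : GradientData δ (modulusConst m M L) (exponentBound m M) (goodConst b δ m M L)
      (Metric.ball x₀ (σ * r₀)) S s (fun x => Q x / p x) u G)
    (hz : IsGoodPoint (goodConst b δ m M L) S (fun x => Q x / p x) G x₀ ((σ - 1) * r₀) z)
    (hxS : x ∈ S) (hx : x ∈ Metric.ball x₀ r₀) :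
    Real.exp (moserTrudingerRate b σ δ m M L * |u x - u z|) ≤
      4 ^ m * (1 + scaleFactor δ (M ^ 2 * L) M (σ - 1) * r₀ ^ Q x₀ * G x ^ p x) := by
  have hσ' : 0 < σ - 1 := sub_pos.2 hσ
  have hρδ : (σ - 1) * r₀ ≤ δ := by linarith
  have hp := h.integrability.pos x
  have hdist : dist x x₀ ≤ (σ - 1)⁻¹ * ((σ - 1) * r₀) := by
    rw [inv_mul_cancel_left₀ hσ'.ne']
    exact (Metric.mem_ball.1 hx).le
  have hle := hdata.abs_sub_le_of_critical (eq_div_of_mul_eq hp.ne' hsp) hρδ hxS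
    (ball_sub_one_mul_subset hx) hdist hz
  have hC := criticalConst_pos (δ := δ) (Λ := modulusConst m M L) (R := exponentBound m M)
    (inv_nonneg.2 hσ'.le) (goodConst_pos hb δ m M L).le
  set C := criticalConst δ (modulusConst m M L) (exponentBound m M) (goodConst b δ m M L)
    (σ - 1)⁻¹ with hC_def
  have hk := moserTrudingerRate_pos hb hσ hm δ M L
  set t := scale (Q x / p x) ((σ - 1) * r₀) (G x)
  have ht : 0 < t := scale_pos hz.radius_pos
  have htρ : 1 ≤ (σ - 1) * r₀ / t :=
    (one_le_div ht).2 (scale_le (div_pos (h.dimension.pos x) hp) hz.radius_pos)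
  calc _ ≤ Real.exp (moserTrudingerRate b σ δ m M L * _) :=
        Real.exp_le_exp.2 (mul_le_mul_of_nonneg_left hle hk.le)
    _ = (4 * ((σ - 1) * r₀ / t)) ^ m := by
        have hlog : Real.log 2 ≠ 0 := (Real.log_pos one_lt_two).ne'
        rw [Real.rpow_def_of_pos (by positivity), moserTrudingerRate, ← hC_def]
        simp only [Real.logb]
        congr 1
        field_simp
    _ ≤ 4 ^ m * ((σ - 1) * r₀ / t) ^ Q x := by
        rw [Real.mul_rpow (by norm_num) (by positivity)]
        gcongr
        exact h.dimension.le_apply h.metricMeasure x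
    _ ≤ _ := by
        gcongr
        exact h.div_scale_rpow_dimension_le hσ hr₀ hρδ hx (hdata.G_nonneg x)

variable [OpensMeasurableSpace X]

lemma lintegral_exp_mul_abs_sub_le (h : Admissible b δ m M L μ Q p s) (hσ : 1 < σ) (hb : 0 < b)
    (hm : 0 < m) (hsp : ∀ x, s x * p x = Q x) (hr₀ : 0 < r₀) (hrδ : σ * r₀ ≤ δ)
    (hS : ∀ᵐ x ∂μ.restrict (Metric.ball x₀ r₀), x ∈ S)
    (hdata : GradientData δ (modulusConst m M L) (exponentBound m M) (goodConst b δ m M L)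
      (Metric.ball x₀ (σ * r₀)) S s (fun x => Q x / p x) u G)
    (hz : IsGoodPoint (goodConst b δ m M L) S (fun x => Q x / p x) G x₀ ((σ - 1) * r₀) z)
    (hint : ∫⁻ x in Metric.ball x₀ r₀, ENNReal.ofReal (G x ^ p x) ∂μ ≤ 1) :
    ∫⁻ x in Metric.ball x₀ r₀,
        ENNReal.ofReal (Real.exp (moserTrudingerRate b σ δ m M L * |u x - u z|)) ∂μ ≤
      ENNReal.ofReal (moserTrudingerBound b σ δ m M L * μ.real (Metric.ball x₀ r₀)) := by
  set B := Metric.ball x₀ r₀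
  set V := scaleFactor δ (M ^ 2 * L) M (σ - 1) with hV_def
  have hV : 0 < V := scaleFactor_pos _ _ _ _
  have : IsFiniteMeasure (μ.restrict B) := ⟨by simpa using (h.metricMeasure x₀ r₀ hr₀).2⟩
  have hB : r₀ ^ Q x₀ ≤ μ.real B / b := by
    rw [le_div_iff₀' hb, ← le_div_iff₀ (by positivity)]
    exact h.le_measureReal_div hr₀ (by nlinarith)
  refine (lintegral_le_of_ae_le_add_mul (H := fun x => G x ^ p x) (ξ := 4 ^ m)
    (η := 4 ^ m * (V * r₀ ^ Q x₀)) (by positivity) (by positivity)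
    (fun x => Real.rpow_nonneg (hdata.G_nonneg x) _) ?_ hint).trans ?_
  · filter_upwards [hS, ae_restrict_mem measurableSet_ball] with x hxS hxB
    refine ENNReal.ofReal_le_ofReal
      ((h.exp_mul_abs_sub_le hσ hb hm (hsp x) hr₀ hrδ hdata hz hxS hxB).trans_eq ?_)
    ring
  · rw [measureReal_restrict_apply_univ, moserTrudingerBound, ← hV_def]
    refine ENNReal.ofReal_le_ofReal ?_
    calc _ ≤ 4 ^ m * μ.real B + 4 ^ m * (V * (μ.real B / b)) := by gcongr
      _ = _ := by ring

lemma integrableOn_and_laverage_exp_le (h : Admissible b δ m M L μ Q p s) (hσ : 1 < σ)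
    (hb : 0 < b) (hb1 : b ≤ 1) (hm : 0 < m) (hsp : ∀ x, s x * p x = Q x) (hr₀ : 0 < r₀)
    (hrδ : σ * r₀ ≤ δ) {g : X → ℝ≥0∞}
    (hu : AEMeasurable u (μ.restrict (Metric.ball x₀ (σ * r₀))))
    (hgrad : IsScalarGradient μ (Metric.ball x₀ (σ * r₀)) s u g)
    (hg : MemLpVar (μ.restrict (Metric.ball x₀ (σ * r₀))) p g) {l : ℝ}
    (hl : luxNorm (μ.restrict (Metric.ball x₀ (σ * r₀))) p g < ENNReal.ofReal l) :
    IntegrableOn u (Metric.ball x₀ r₀) μ ∧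
      ⨍⁻ x in Metric.ball x₀ r₀, ENNReal.ofReal (Real.exp (moserTrudingerRate b σ δ m M L *
        (|u x - ⨍ y in Metric.ball x₀ r₀, u y ∂μ| / l))) ∂μ ≤
        ENNReal.ofReal (moserTrudingerBound b σ δ m M L ^ 2) := by
  have hl0 : 0 < l := ENNReal.ofReal_pos.1 (bot_le.trans_lt hl)
  obtain ⟨hB0, hB_top⟩ := h.metricMeasure x₀ r₀ hr₀
  have : IsFiniteMeasure (μ.restrict (Metric.ball x₀ r₀)) := ⟨by simpa using hB_top⟩
  have : NeZero (μ.restrict (Metric.ball x₀ r₀)) :=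
    ⟨fun h0 => hB0.ne' (Measure.restrict_eq_zero.1 h0)⟩
  have hball : Metric.ball x₀ r₀ ⊆ Metric.ball x₀ (σ * r₀) :=
    Metric.ball_subset_ball (by nlinarith)
  obtain ⟨S, hS, hdata⟩ := h.exists_gradientData hb hb1 hm measurableSet_ball hgrad hg
  obtain ⟨z, hz⟩ := (hdata l hl).exists_isGoodPoint x₀ ((σ - 1) * r₀)
    (mul_pos (sub_pos.2 hσ) hr₀) (by linarith)
    (ball_sub_one_mul_subset (Metric.mem_ball_self hr₀))
  have hint := lintegral_rpow_toReal_div_le_one_of_luxNorm_lt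
    (fun x => (h.integrability.pos x).le) hl
  have hexp := h.lintegral_exp_mul_abs_sub_le hσ hb hm hsp hr₀ hrδ
    (ae_restrict_of_ae_restrict_of_subset hball hS) (hdata l hl) hz
    ((lintegral_mono_set hball).trans hint)
  have hu_B : AEMeasurable u (μ.restrict (Metric.ball x₀ r₀)) :=
    hu.mono_measure (Measure.restrict_mono_set μ hball)
  rw [← measureReal_restrict_apply_univ] at hexp
  obtain ⟨hint_l, hle⟩ := integrable_and_laverage_exp_le_of_lintegral_exp_le
    (moserTrudingerRate_pos hb hσ hm δ M L) (hu_B.div_const l).aestronglyMeasurable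
    (moserTrudingerBound_pos hb σ δ m M L).le hexp
  refine ⟨(hint_l.mul_const l).congr (ae_of_all _ fun x => div_mul_cancel₀ _ hl0.ne'), ?_⟩
  simpa only [average_eq, integral_div, smul_eq_mul,
    ← mul_div_assoc, ← sub_div, abs_div, abs_of_pos hl0]
    using hle

theorem moser_trudinger (h : Admissible b δ m M L μ Q p s) (hσ : 1 < σ)
    (hb : 0 < b) (hb1 : b ≤ 1) (hm : 0 < m) (hsp : ∀ x, s x * p x = Q x) (hr₀ : 0 < r₀)
    (hrδ : σ * r₀ ≤ δ) {g : X → ℝ≥0∞}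
    (hu : AEMeasurable u (μ.restrict (Metric.ball x₀ (σ * r₀))))
    (hgrad : IsScalarGradient μ (Metric.ball x₀ (σ * r₀)) s u g)
    (hg : MemLpVar (μ.restrict (Metric.ball x₀ (σ * r₀))) p g) :
    IntegrableOn u (Metric.ball x₀ r₀) μ ∧
      (0 < luxNorm (μ.restrict (Metric.ball x₀ (σ * r₀))) p g →
        ⨍⁻ x in Metric.ball x₀ r₀, ENNReal.ofReal (Real.exp (moserTrudingerRate b σ δ m M L / 2 *
          (|u x - ⨍ y in Metric.ball x₀ r₀, u y ∂μ| /
            (luxNorm (μ.restrict (Metric.ball x₀ (σ * r₀))) p g).toReal))) ∂μ ≤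
          ENNReal.ofReal (moserTrudingerBound b σ δ m M L ^ 2)) := by
  set n := luxNorm (μ.restrict (Metric.ball x₀ (σ * r₀))) p g
  have hn : n ≠ ∞ := (luxNorm_lt_top hm (h.integrability.le_apply h.metricMeasure) hg.2).ne
  have hmain (l : ℝ) (hl : n.toReal < l) := h.integrableOn_and_laverage_exp_le hσ hb hb1 hm hsp
    hr₀ hrδ hu hgrad hg ((ENNReal.lt_ofReal_iff_toReal_lt hn).2 hl)
  refine ⟨(hmain _ (lt_add_one _)).1, fun hn0 => ?_⟩
  have hlt : n.toReal < 2 * n.toReal := by linarith [ENNReal.toReal_pos hn0.ne' hn]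
  simpa only [mul_div_assoc', div_mul_eq_mul_div, div_div] using (hmain _ hlt).2

end Admissible

end MoserTrudinger

section Morrey

lemma le_holderConst {σ δ C a r : ℝ} (hσ : 1 < σ) (hr : 0 < r) (hrδ : σ * r ≤ δ) (hC : 0 ≤ C)
    (ha : 0 ≤ a) : C ≤ holderConst σ δ C a r := by
  have : 0 < σ - 1 := sub_pos.2 hσ
  have hpow : (1 : ℝ) ≤ 2 ^ (a + 1) := Real.one_le_rpow one_le_two (by linarith)
  have hδ : 0 < δ := (mul_pos (by linarith) hr).trans_le hrδ
  have hratio : 1 ≤ (σ * δ / ((σ - 1) * r)) ^ a := by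
    refine Real.one_le_rpow ?_ ha
    rw [one_le_div (by positivity)]
    nlinarith
  calc C = 1 * C * 1 := by ring
    _ ≤ holderConst σ δ C a r := by
        unfold holderConst
        gcongr

lemma mul_dist_le_of_mem_ball [PseudoMetricSpace X] {x y x₀ : X} {σ r : ℝ} (hσ : 1 ≤ σ)
    (hx : x ∈ Metric.ball x₀ r) (hy : y ∈ Metric.ball x₀ r) :
    (σ - 1) / (σ + 1) * dist x y ≤ (σ - 1) * r := by
  have : 0 ≤ σ - 1 := sub_nonneg.2 hσ
  have hr : 0 < r := Metric.pos_of_mem_ball hx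
  have hdist : dist x y ≤ 2 * r := by
    linarith [dist_triangle_right x y x₀, Metric.mem_ball.1 hx, Metric.mem_ball.1 hy]
  calc (σ - 1) / (σ + 1) * dist x y ≤ (σ - 1) / (σ + 1) * ((σ + 1) * r) := by
        gcongr
        nlinarith
    _ = (σ - 1) * r := by field_simp

/-- The Hölder constant of a function whose gradient has norm less than one, on a set of full
measure in the ball. -/
def holderSeminormConst (b σ δ m M L θ : ℝ) : ℝ :=
  supercriticalConst δ (modulusConst m M L) (exponentBound m M) (goodConst b δ m M L)
    ((σ - 1) / (σ + 1))⁻¹ (θ / M)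

/-- The constant in the Morrey inequality. The summand containing `scaleFactor` accounts for
freezing the Hölder exponent at the centre of the ball. -/
def morreyConst (b σ δ m M L θ : ℝ) : ℝ :=
  holderSeminormConst b σ δ m M L θ * (1 + scaleFactor (2 * δ) (modulusConst m M L) M 2)

lemma holderSeminormConst_pos {b σ : ℝ} (hb : 0 < b) (hσ : 1 < σ) (δ m M L θ : ℝ) :
    0 < holderSeminormConst b σ δ m M L θ :=
  supercriticalConst_pos (inv_nonneg.2 (div_nonneg (by linarith) (by linarith)))
    (goodConst_pos hb δ m M L).le

lemma morreyConst_pos {b σ : ℝ} (hb : 0 < b) (hσ : 1 < σ) (δ m M L θ : ℝ) :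
    0 < morreyConst b σ δ m M L θ :=
  mul_pos (holderSeminormConst_pos hb hσ δ m M L θ) (add_pos one_pos (scaleFactor_pos _ _ _ _))

lemma holderSeminormConst_le_morreyConst {b σ : ℝ} (hb : 0 < b) (hσ : 1 < σ) (δ m M L θ : ℝ) :
    holderSeminormConst b σ δ m M L θ ≤ morreyConst b σ δ m M L θ :=
  le_mul_of_one_le_right (holderSeminormConst_pos hb hσ δ m M L θ).le
    (le_add_of_nonneg_right (scaleFactor_pos _ _ _ _).le)

namespace Admissible

variable [MetricSpace X] [MeasurableSpace X] {μ : Measure X} {b σ δ m M L θ r₀ : ℝ}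
  {Q p s : X → ℝ} {x x₀ y : X} {u : X → ℝ}

lemma hasLogModulus_holderExp (h : Admissible b δ m M L μ Q p s) (hm : 0 < m) :
    HasLogModulus (modulusConst m M L) (holderExp Q p s) :=
  (h.smoothness.hasLogModulus h.metricMeasure).sub
    (h.integrability.hasLogModulus_div h.dimension h.metricMeasure hm)

lemma holderExp_le (h : Admissible b δ m M L μ Q p s) (x : X) : holderExp Q p s x ≤ M :=
  (sub_le_self _ (div_pos (h.dimension.pos x) (h.integrability.pos x)).le).trans
    (h.smoothness.apply_le h.metricMeasure x)

lemma le_holderExp (h : Admissible b δ m M L μ Q p s) (hθ : 0 ≤ θ) (hsp : Q x + θ ≤ s x * p x) :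
    θ / M ≤ holderExp Q p s x :=
  VarExp.le_holderExp (h.integrability.pos x) (h.integrability.apply_le h.metricMeasure x) hθ hsp

lemma essSup_holderExp_nonneg [Nonempty X] (h : Admissible b δ m M L μ Q p s)
    (hα : ∀ x, 0 ≤ holderExp Q p s x) : 0 ≤ essSup (holderExp Q p s) μ := by
  have : (ae μ).NeBot := by
    obtain ⟨x⟩ := ‹Nonempty X›
    refine ae_neBot.2 fun h0 => ?_
    simpa [h0] using (h.metricMeasure x 1 one_pos).1
  have hle : ∀ᵐ x ∂μ, holderExp Q p s x ≤ essSup (holderExp Q p s) μ :=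
    ae_le_essSup ⟨M, eventually_map.2 (Eventually.of_forall h.holderExp_le)⟩
  obtain ⟨x, hx⟩ := hle.exists
  exact (hα x).trans hx

lemma dist_rpow_holderExp_le (h : Admissible b δ m M L μ Q p s) (hm : 0 < m)
    (hα : ∀ x, 0 ≤ holderExp Q p s x) (hr₀ : 0 < r₀) (hrδ : r₀ ≤ δ) (hx : x ∈ Metric.ball x₀ r₀)
    (hy : y ∈ Metric.ball x₀ r₀) :
    dist x y ^ holderExp Q p s x ≤
      scaleFactor (2 * δ) (modulusConst m M L) M 2 * r₀ ^ holderExp Q p s x₀ := by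
  have hdist : dist x y ≤ 2 * r₀ := by
    linarith [dist_triangle_right x y x₀, Metric.mem_ball.1 hx, Metric.mem_ball.1 hy]
  have habs : |holderExp Q p s x₀| ≤ M := by
    rw [abs_of_nonneg (hα x₀)]
    exact h.holderExp_le x₀
  exact (Real.rpow_le_rpow dist_nonneg hdist (hα x)).trans
    ((h.hasLogModulus_holderExp hm).mul_rpow_le two_pos hr₀ (by linarith) habs
      (Metric.mem_ball.1 hx).le)

lemma holderSeminormConst_mul_dist_rpow_le (h : Admissible b δ m M L μ Q p s) (hσ : 1 < σ)
    (hb : 0 < b) (hm : 0 < m) (hα : ∀ x, 0 ≤ holderExp Q p s x) (hr₀ : 0 < r₀) (hrδ : r₀ ≤ δ)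
    (hx : x ∈ Metric.ball x₀ r₀) (hy : y ∈ Metric.ball x₀ r₀) {l : ℝ} (hl : 0 ≤ l) :
    holderSeminormConst b σ δ m M L θ * l * dist x y ^ holderExp Q p s x ≤
      morreyConst b σ δ m M L θ * r₀ ^ holderExp Q p s x₀ * l := by
  have hC := holderSeminormConst_pos hb hσ δ m M L θ
  calc _ ≤ holderSeminormConst b σ δ m M L θ * l *
        (scaleFactor (2 * δ) (modulusConst m M L) M 2 * r₀ ^ holderExp Q p s x₀) := by
        gcongr
        exact h.dist_rpow_holderExp_le hm hα hr₀ hrδ hx hy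
    _ ≤ holderSeminormConst b σ δ m M L θ * l *
        ((1 + scaleFactor (2 * δ) (modulusConst m M L) M 2) * r₀ ^ holderExp Q p s x₀) := by
        gcongr
        exact le_add_of_nonneg_left zero_le_one
    _ = _ := by
        rw [morreyConst]
        ring

variable [OpensMeasurableSpace X] {g : X → ℝ≥0∞}

lemma exists_ae_abs_sub_le (h : Admissible b δ m M L μ Q p s) (hσ : 1 < σ) (hb : 0 < b)
    (hb1 : b ≤ 1) (hm : 0 < m) (hθ : 0 < θ) (hsp : ∀ x, Q x + θ ≤ s x * p x) (hr₀ : 0 < r₀)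
    (hrδ : σ * r₀ ≤ δ) (hgrad : IsScalarGradient μ (Metric.ball x₀ (σ * r₀)) s u g)
    (hg : MemLpVar (μ.restrict (Metric.ball x₀ (σ * r₀))) p g) :
    ∃ S ⊆ Metric.ball x₀ r₀, (∀ᵐ x ∂μ.restrict (Metric.ball x₀ r₀), x ∈ S) ∧
      ∀ x ∈ S, ∀ y ∈ S, |u x - u y| ≤ holderSeminormConst b σ δ m M L θ *
        (luxNorm (μ.restrict (Metric.ball x₀ (σ * r₀))) p g).toReal *
          dist x y ^ holderExp Q p s x := by
  have hball : Metric.ball x₀ r₀ ⊆ Metric.ball x₀ (σ * r₀) :=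
    Metric.ball_subset_ball (by nlinarith)
  have hn := (luxNorm_lt_top hm (h.integrability.le_apply h.metricMeasure) hg.2).ne
  have hM := h.bound_pos x₀
  obtain ⟨S, hS, hdata⟩ := h.exists_gradientData hb hb1 hm measurableSet_ball hgrad hg
  refine ⟨Metric.ball x₀ r₀ ∩ S, inter_subset_left, ?_, fun x hx y hy => ?_⟩
  · filter_upwards [ae_restrict_of_ae_restrict_of_subset hball hS,
      ae_restrict_mem measurableSet_ball] with x hxS hxB using ⟨hxB, hxS⟩
  set τ := (σ - 1) / (σ + 1)
  have hτ : 0 < τ := div_pos (by linarith) (by linarith)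
  have hτ1 : τ ≤ 1 := (div_le_one (by linarith)).2 (by linarith)
  have hxy := mul_dist_le_of_mem_ball hσ.le hx.1 hy.1
  refine le_apply_toReal_of_forall_lt_ofReal (F := fun l =>
    holderSeminormConst b σ δ m M L θ * l * dist x y ^ holderExp Q p s x)
    (by fun_prop) hn fun l hl => ?_
  have hl0 : 0 < l := ENNReal.ofReal_pos.1 (bot_le.trans_lt hl)
  have hle := (hdata l hl).abs_sub_le_of_supercritical hτ hτ1 (div_pos hθ hM)
    (fun x => h.le_holderExp hθ.le (hsp x)) hx.2 hy.2 (by linarith)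
    ((Metric.ball_subset_ball hxy).trans (ball_sub_one_mul_subset hx.1))
    ((Metric.ball_subset_ball hxy).trans (ball_sub_one_mul_subset hy.1))
  rw [← sub_div, abs_div, abs_of_pos hl0, div_le_iff₀ hl0, mul_right_comm] at hle
  exact hle

lemma exists_continuousOn_ae_eq_abs_sub_le (h : Admissible b δ m M L μ Q p s) (hm : 0 < m)
    (hα : ∀ x, 0 < holderExp Q p s x) {U S : Set X} (hU : IsOpen U)
    (hS : ∀ᵐ x ∂μ.restrict U, x ∈ S) {C : ℝ}
    (hu : ∀ x ∈ S, ∀ y ∈ S, |u x - u y| ≤ C * dist x y ^ holderExp Q p s x) :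
    ∃ v : X → ℝ, ContinuousOn v U ∧ u =ᵐ[μ.restrict U] v ∧
      ∀ x ∈ U, ∀ y ∈ U, |v x - v y| ≤ C * dist x y ^ holderExp Q p s x := by
  let ω : X × X → ℝ := fun z => C * dist z.1 z.2 ^ holderExp Q p s z.1
  have hω : Continuous ω := by
    have := (h.hasLogModulus_holderExp hm).continuous
    exact continuous_const.mul (continuous_dist.rpow (this.comp continuous_fst)
      fun z => Or.inr (hα z.1))
  have hω0 (x : X) : ω (x, x) = 0 := by
    simp only [ω, dist_self, Real.zero_rpow (hα x).ne', mul_zero]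
  have hdense : U ⊆ closure S := fun x hx => by
    have hx' := h.metricMeasure.dense_of_ae ((ae_restrict_iff' hU.measurableSet).1 hS) x
    exact closure_mono (fun y hy => hy.2 hy.1) (hU.inter_closure ⟨hx, hx'⟩)
  refine ⟨extendFrom S u, ?_, ?_, fun x hx y hy => ?_⟩
  · exact continuousOn_extendFrom hdense fun x hx =>
      exists_tendsto_of_dist_le hω hω0 hu (hdense hx)
  · filter_upwards [hS] with x hx using (extendFrom_eq_of_dist_le hω hω0 hu hx).symm
  · exact dist_extendFrom_le (u := u) hω hω0 hu (hdense hx) (hdense hy)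

theorem morrey (h : Admissible b δ m M L μ Q p s) (hσ : 1 < σ) (hb : 0 < b) (hb1 : b ≤ 1)
    (hm : 0 < m) (hθ : 0 < θ) (hsp : ∀ x, Q x + θ ≤ s x * p x) (hr₀ : 0 < r₀)
    (hrδ : σ * r₀ ≤ δ) (hu : AEMeasurable u (μ.restrict (Metric.ball x₀ (σ * r₀))))
    (hgrad : IsScalarGradient μ (Metric.ball x₀ (σ * r₀)) s u g)
    (hg : MemLpVar (μ.restrict (Metric.ball x₀ (σ * r₀))) p g) :
    IntegrableOn u (Metric.ball x₀ r₀) μ ∧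
      eLpNorm (fun x => u x - ⨍ y in Metric.ball x₀ r₀, u y ∂μ) ∞
          (μ.restrict (Metric.ball x₀ r₀)) ≤
        ENNReal.ofReal (morreyConst b σ δ m M L θ * r₀ ^ holderExp Q p s x₀) *
          luxNorm (μ.restrict (Metric.ball x₀ (σ * r₀))) p g ∧
      ∃ v : X → ℝ, ContinuousOn v (Metric.ball x₀ r₀) ∧
        u =ᵐ[μ.restrict (Metric.ball x₀ r₀)] v ∧
        ∀ x ∈ Metric.ball x₀ r₀, ∀ y ∈ Metric.ball x₀ r₀,
          |v x - v y| ≤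
            holderConst σ δ (morreyConst b σ δ m M L θ) (essSup (holderExp Q p s) μ) r₀ *
              (luxNorm (μ.restrict (Metric.ball x₀ (σ * r₀))) p g).toReal *
              dist x y ^ holderExp Q p s x := by
  set n := luxNorm (μ.restrict (Metric.ball x₀ (σ * r₀))) p g
  have hn : n ≠ ∞ := (luxNorm_lt_top hm (h.integrability.le_apply h.metricMeasure) hg.2).ne
  have hα (x : X) : 0 < holderExp Q p s x :=
    (div_pos hθ (h.bound_pos x)).trans_le (h.le_holderExp hθ.le (hsp x))
  have hC := morreyConst_pos hb hσ δ m M L θ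
  have : Nonempty X := ⟨x₀⟩
  obtain ⟨hB0, hB_top⟩ := h.metricMeasure x₀ r₀ hr₀
  have : IsFiniteMeasure (μ.restrict (Metric.ball x₀ r₀)) := ⟨by simpa using hB_top⟩
  have : NeZero (μ.restrict (Metric.ball x₀ r₀)) :=
    ⟨fun h0 => hB0.ne' (Measure.restrict_eq_zero.1 h0)⟩
  obtain ⟨S, hSB, hS, hSu⟩ := h.exists_ae_abs_sub_le hσ hb hb1 hm hθ hsp hr₀ hrδ hgrad hg
  have hu_B : AEMeasurable u (μ.restrict (Metric.ball x₀ r₀)) :=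
    hu.mono_measure (Measure.restrict_mono_set μ (Metric.ball_subset_ball (by nlinarith)))
  obtain ⟨hint, hdev⟩ := integrable_and_eLpNorm_sub_average_le hu_B.aestronglyMeasurable hS
    fun x hx y hy => (hSu x hx y hy).trans
      (h.holderSeminormConst_mul_dist_rpow_le hσ hb hm (fun x => (hα x).le) hr₀ (by nlinarith)
        (hSB hx) (hSB hy) n.toReal_nonneg)
  obtain ⟨v, hv, huv, hvv⟩ :=
    h.exists_continuousOn_ae_eq_abs_sub_le hm hα Metric.isOpen_ball hS hSu
  refine ⟨hint, ?_, v, hv, huv, fun x hx y hy => (hvv x hx y hy).trans ?_⟩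
  · rwa [ENNReal.ofReal_mul (by positivity), ENNReal.ofReal_toReal hn] at hdev
  · gcongr
    exact (holderSeminormConst_le_morreyConst hb hσ δ m M L θ).trans
      (le_holderConst hσ hr₀ hrδ hC.le (h.essSup_holderExp_nonneg fun x => (hα x).le))

end Admissible

end Morrey

end VarExp

end

theorem mainTheorem1 (b σ δ m M L : ℝ) (hb : 0 < b) (hb1 : b ≤ 1) (hσ : 1 < σ) (hδ : 0 < δ)
    (hm : 0 < m) (hL : 0 < L) :
    -- (i) Sobolev–Poincaré
    (∀ θ : ℝ, 0 < θ → ∃ CS : ℝ, 0 < CS ∧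
      ∀ (X : Type u) [MetricSpace X] [MeasurableSpace X] [BorelSpace X] (μ : Measure X)
        (Q p s : X → ℝ), VarExp.Admissible b δ m M L μ Q p s →
        (∀ᵐ x ∂μ, s x * p x + θ ≤ Q x) →
        ∀ (x₀ : X) (r₀ : ℝ), 0 < r₀ → r₀ ≤ δ / σ →
        ∀ (u : X → ℝ) (g : X → ℝ≥0∞),
          VarExp.IsHajlaszPair μ (Metric.ball x₀ (σ * r₀)) s p u g →
          (⨅ c : ℝ, VarExp.luxNorm (μ.restrict (Metric.ball x₀ r₀)) (VarExp.sobolevConj Q p s)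
              (fun x => ‖u x - c‖ₑ)) ≤
            ENNReal.ofReal (CS * (μ.real (Metric.ball x₀ r₀) / r₀ ^ Q x₀) ^
                (1 / essInf (VarExp.sobolevConj Q p s) (μ.restrict (Metric.ball x₀ r₀)))) *
              VarExp.luxNorm (μ.restrict (Metric.ball x₀ (σ * r₀))) p g) ∧
    -- (ii) Moser–Trudinger
    (∃ C₁ C₂ : ℝ, 0 < C₁ ∧ 0 < C₂ ∧
      ∀ (X : Type u) [MetricSpace X] [MeasurableSpace X] [BorelSpace X] (μ : Measure X)
        (Q p s : X → ℝ), VarExp.Admissible b δ m M L μ Q p s →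
        (∀ x, s x * p x = Q x) →
        ∀ (x₀ : X) (r₀ : ℝ), 0 < r₀ → r₀ ≤ δ / σ →
        ∀ (u : X → ℝ) (g : X → ℝ≥0∞),
          VarExp.IsHajlaszPair μ (Metric.ball x₀ (σ * r₀)) s p u g →
          IntegrableOn u (Metric.ball x₀ r₀) μ ∧
          (0 < VarExp.luxNorm (μ.restrict (Metric.ball x₀ (σ * r₀))) p g →
            (⨍⁻ x in Metric.ball x₀ r₀, ENNReal.ofReal (Real.exp
                (C₁ * (|u x - ⨍ y in Metric.ball x₀ r₀, u y ∂μ| /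
                  (VarExp.luxNorm (μ.restrict (Metric.ball x₀ (σ * r₀))) p g).toReal))) ∂μ) ≤
              ENNReal.ofReal C₂)) ∧
    -- (iii) Morrey
    (∀ θ : ℝ, 0 < θ → ∃ CH : ℝ, 0 < CH ∧
      ∀ (X : Type u) [MetricSpace X] [MeasurableSpace X] [BorelSpace X] (μ : Measure X)
        (Q p s : X → ℝ), VarExp.Admissible b δ m M L μ Q p s →
        (∀ᵐ x ∂μ, Q x + θ ≤ s x * p x) →
        ∀ (x₀ : X) (r₀ : ℝ), 0 < r₀ → r₀ ≤ δ / σ →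
        ∀ (u : X → ℝ) (g : X → ℝ≥0∞),
          VarExp.IsHajlaszPair μ (Metric.ball x₀ (σ * r₀)) s p u g →
          IntegrableOn u (Metric.ball x₀ r₀) μ ∧
          eLpNorm (fun x => u x - ⨍ y in Metric.ball x₀ r₀, u y ∂μ) ∞
              (μ.restrict (Metric.ball x₀ r₀)) ≤
            ENNReal.ofReal (CH * r₀ ^ VarExp.holderExp Q p s x₀) *
              VarExp.luxNorm (μ.restrict (Metric.ball x₀ (σ * r₀))) p g ∧
          ∃ v : X → ℝ, ContinuousOn v (Metric.ball x₀ r₀) ∧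
            u =ᵐ[μ.restrict (Metric.ball x₀ r₀)] v ∧
            ∀ x ∈ Metric.ball x₀ r₀, ∀ y ∈ Metric.ball x₀ r₀,
              |v x - v y| ≤
                VarExp.holderConst σ δ CH (essSup (VarExp.holderExp Q p s) μ) r₀ *
                  (VarExp.luxNorm (μ.restrict (Metric.ball x₀ (σ * r₀))) p g).toReal *
                  dist x y ^ VarExp.holderExp Q p s x) := by
  have hσr {r₀ : ℝ} (hr : r₀ ≤ δ / σ) : σ * r₀ ≤ δ := (le_div_iff₀' (by linarith)).1 hr
  refine ⟨fun θ hθ => ⟨VarExp.sobolevConst b σ δ m M L θ,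
    VarExp.sobolevConst_pos hb hσ δ m M L θ, ?_⟩, ⟨VarExp.moserTrudingerRate b σ δ m M L / 2,
    VarExp.moserTrudingerBound b σ δ m M L ^ 2,
    half_pos (VarExp.moserTrudingerRate_pos hb hσ hm δ M L),
    pow_pos (VarExp.moserTrudingerBound_pos hb σ δ m M L) 2, ?_⟩, fun θ hθ =>
    ⟨VarExp.morreyConst b σ δ m M L θ, VarExp.morreyConst_pos hb hσ δ m M L θ, ?_⟩⟩
  · rintro X _ _ _ μ Q p s h hsp x₀ r₀ hr₀ hr u g ⟨-, hgrad, hg⟩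
    have hsp' := h.metricMeasure.forall_le_of_ae
      ((h.smoothness.continuous.mul h.integrability.continuous).add continuous_const)
      h.dimension.continuous hsp
    exact h.sobolev_poincare hσ hb hb1 hm hθ hsp' hr₀ (hσr hr) hgrad hg
  · rintro X _ _ _ μ Q p s h hsp x₀ r₀ hr₀ hr u g ⟨⟨hu, -⟩, hgrad, hg⟩
    exact h.moser_trudinger hσ hb hb1 hm hsp hr₀ (hσr hr) hu hgrad hg
  · rintro X _ _ _ μ Q p s h hsp x₀ r₀ hr₀ hr u g ⟨⟨hu, -⟩, hgrad, hg⟩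
    have hsp' := h.metricMeasure.forall_le_of_ae
      (h.dimension.continuous.add continuous_const)
      (h.smoothness.continuous.mul h.integrability.continuous) hsp
    exact h.morrey hσ hb hb1 hm hθ hsp' hr₀ (hσr hr) hu hgrad hg
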